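/- Let $K$ be an algebraically closed field of characteristic $0$ and let $X$ be a smooth irreducible variety (an integral separated scheme of finite type) of dimension $N$ over $K$, for instance a smooth irreducible quasi-projective variety. Write $\mathcal A$ for the structure sheaf, $\mathcal V$ for the sheaf of vector fields and $\Omega^1$ for the sheaf of differentials of $X$ over $K$. An étale chart of $X$ is an affine open set $U\subset X$ with functions $x_1,\dots,x_N\in A=\mathcal A(U)$ (uniformizing parameters) which are algebraically independent over $K$, such that every $f\in A$ is algebraic over $K[x_1,\dots,x_N]$ and the derivations $\partial/\partial x_i$ of $K[x_1,\dots,x_N]$ extend to $A$ (the extensions are then unique). For $f\in A$ write $$f(x+X)=\sum_{m\in\mathbb Z_{\ge 0}^N}\frac1{m!}\frac{\partial^m f}{\partial x^m}X^m\in A[[X_1,\dots,X_N]]$$ for its Taylor expansion. Let $\mathcal L_k$ be the space of polynomial vector fields $\sum_j v_j(X)\,\partial/\partial X_j$ in $N$ variables over $K$ with all $v_j$ homogeneous of degree $k+1$, and let $\widehat{\mathcal L}_+=\prod_{k\ge 0}\mathcal L_k$ be the Lie algebra of formal vector fields vanishing at the origin. Theorem. The étale charts cover $X$, and there is a vector bundle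 $E$ on $X$ with fibre $\widehat{\mathcal L}_+$ (a sheaf of $\mathcal A$-modules, identified over each étale chart with the sheaf $W\mapsto\mathcal A(W)\,\widehat\otimes\,\widehat{\mathcal L}_+$ of formal vector fields vanishing at the origin with coefficients in $\mathcal A(W)$, the transition maps being $\mathcal A$-linear and continuous) with the following properties. (1) Let $(U_1;x_1,\dots,x_N)$ and $(U_2;y_1,\dots,y_N)$ be étale charts. Then the restrictions of $x$ and of $y$ are uniformizing parameters on $U_1\cap U_2$. Write $x_i=G_i(y)$ and $y_j=H_j(x)$ for them as elements of $\mathcal A(U_1\cap U_2)$. The transition function from the first chart to the second is given, for all $m\in\mathbb Z_{\ge 0}^N\setminus\{0\}$ and $1\le p\le N$, by $$X^m\frac{\partial}{\partial X_p}\mapsto\sum_{0\le k\le m}(-1)^{m-k}\binom mk G(y)^{m-k}\sum_{q=1}^N\left(G(y+Y)^k\,\frac{\partial H_q}{\partial x_p}(G(y+Y))-G(y)^k\,\frac{\partial H_q}{\partial x_p}(G(y))\right)\frac{\partial}{\partial Y_q}$$ and extended to power series by linearity and continuity. Here $m$ and $k$ are multi-indices, $(-1)^{m-k}$ means $(-1)^{|m-k|}$,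 $\frac{\partial H_q}{\partial x_p}(G(y))$ is the function $\frac{\partial y_q}{\partial x_p}$ on $U_1\cap U_2$, and replacing $y$ by $y+Y$ means Taylor expansion with respect to the parameters $y$. (2) $E$ has a decreasing filtration $E=F_0\supset F_1\supset F_2\supset\cdots$ by subbundles such that in the trivialization over every étale chart $F_r$ corresponds to $\prod_{k\ge r}\mathcal L_k$. Over every étale chart the quotient $E/F_r$ is free of finite rank $\dim\bigoplus_{k<r}\mathcal L_k$. (3) The quotient $E/F_1$ is isomorphic to the bundle $\Omega^1\otimes_{\mathcal A}\mathcal V$ of $(1,1)$-tensors, by an isomorphism which over every étale chart sends the class of a section with linear part $\sum_{i,j}a_{ij}X_i\,\partial/\partial X_j$ to $\sum_{i,j}a_{ij}\,dx_i\otimes\partial/\partial x_j$. -/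

import Mathlib

open AlgebraicGeometry CategoryTheory CategoryTheory.Limits Opposite

universe u

noncomputable section

/-! ### Uniformizing parameters, Taylor expansions -/

/-- `x₁, …, x_N` are uniformizing parameters of the `K`-algebra `A`: they are algebraically
independent, `A` is algebraic over `K[x₁, …, x_N]`, and the derivations `∂/∂xᵢ` of
`K[x₁, …, x_N]` extend to derivations of `A`. -/
structure IsUniformizing (K : Type u) {A : Type u} [Field K] [CommRing A] [Algebra K A]
    {N : ℕ} (x : Fin N → A) : Prop where
  algebraicIndependent : AlgebraicIndependent K x
  algebraic : ∀ f : A, IsAlgebraic (Algebra.adjoin K (Set.range x)) f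
  exists_derivation : ∀ i : Fin N, ∃ D : Derivation K A A, ∀ p : MvPolynomial (Fin N) K,
    D (MvPolynomial.aeval x p) = MvPolynomial.aeval x (MvPolynomial.pderiv i p)

namespace IsUniformizing

variable {K A : Type u} [Field K] [CommRing A] [Algebra K A] {N : ℕ} {x : Fin N → A}

/-- The derivation `∂/∂xᵢ` of `A`. When `A` is a domain and `K` has characteristic `0`, as is the case
below, it is the only derivation extending `∂/∂xᵢ`, since `A` is algebraic over `K[x₁, …, x_N]`. -/
def pderiv (h : IsUniformizing K x) (i : Fin N) : Derivation K A A :=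
  (h.exists_derivation i).choose

lemma pderiv_aeval (h : IsUniformizing K x) (i : Fin N) (p : MvPolynomial (Fin N) K) :
    h.pderiv i (MvPolynomial.aeval x p) = MvPolynomial.aeval x (MvPolynomial.pderiv i p) :=
  (h.exists_derivation i).choose_spec p

/-- The iterated derivative `∂^m = (∂/∂x₁)^{m₁} ⋯ (∂/∂x_N)^{m_N}`. -/
def iterPderiv (h : IsUniformizing K x) (m : Fin N →₀ ℕ) : A →ₗ[K] A :=
  ((List.finRange N).map fun i => ((h.pderiv i : A →ₗ[K] A) ^ m i : Module.End K A)).prod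

/-- The Taylor expansion `f(x + X) = ∑ₘ (1 / m!) (∂^m f / ∂x^m) X^m` in `A[[X₁, …, X_N]]`. -/
def taylor (h : IsUniformizing K x) (f : A) : MvPowerSeries (Fin N) A :=
  fun m => ((∏ i, (m i).factorial : ℕ) : K)⁻¹ • h.iterPderiv m f

end IsUniformizing

/-! ### The fibre: formal vector fields vanishing at the origin -/

/-- Formal vector fields `∑ⱼ vⱼ(X) ∂/∂Xⱼ` in `N` variables with coefficients in `A`, given by their
components `vⱼ`. -/
abbrev FormalVF (N : ℕ) (A : Type u) [CommRing A] : Type u := Fin N → MvPowerSeries (Fin N) A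

/-- The completed tensor product of `A` with `∏_{k ≥ r} 𝓛ₖ`, where `𝓛ₖ` consists of the vector
fields homogeneous of degree `k` (their components are homogeneous polynomials of degree `k + 1`):
the formal vector fields whose components only have terms of degree at least `r + 1`. -/
def formalVFGE (N : ℕ) (A : Type u) [CommRing A] (r : ℕ) : Submodule A (FormalVF N A) where
  carrier := {v | ∀ (j : Fin N) (m : Fin N →₀ ℕ), m.degree ≤ r → MvPowerSeries.coeff m (v j) = 0}
  add_mem' hv hw j m hm := by simp [hv j m hm, hw j m hm]
  zero_mem' j m _ := by simp
  smul_mem' a v hv j m hm := by simp [hv j m hm]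

/-- `A ⊗̂ 𝓛̂₊`, with `𝓛̂₊ = ∏_{k ≥ 0} 𝓛ₖ` the Lie algebra of formal vector fields vanishing at the
origin. For `A = K` this is `𝓛̂₊` itself. -/
abbrev LPlus (N : ℕ) (A : Type u) [CommRing A] : Type u := formalVFGE N A 0

/-- The vector field `X^m ∂/∂X_p`, for `m ≠ 0`. -/
def LPlus.monomial {N : ℕ} (A : Type u) [CommRing A] (m : Fin N →₀ ℕ) (hm : m ≠ 0) (p : Fin N) :
    LPlus N A :=
  ⟨Pi.single p (MvPowerSeries.monomial m 1), by
    classical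
    intro j n hn
    have hn0 : n = 0 := (Finsupp.degree_eq_zero_iff n).1 (Nat.le_zero.1 hn)
    subst hn0
    by_cases h : j = p
    · subst h
      simp [MvPowerSeries.coeff_monomial, hm.symm]
    · simp [h]⟩

/-- The right hand side of the transition formula, for two systems of uniformizing parameters
`x = G(y)` and `y = H(x)` of the same algebra `A`:
`∑_{0 ≤ k ≤ m} (-1)^{m-k} (m choose k) G(y)^{m-k} ∑_q
  (G(y+Y)^k (∂H_q/∂x_p)(G(y+Y)) - G(y)^k (∂H_q/∂x_p)(G(y))) ∂/∂Y_q`.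
As elements of `A`, `Gᵢ(y) = xᵢ` and `(∂H_q/∂x_p)(G(y)) = ∂y_q/∂x_p`; replacing `y` by `y + Y` is
Taylor expansion with respect to the parameters `y`. -/
def transitionFormula {K A : Type u} [Field K] [CommRing A] [Algebra K A] {N : ℕ}
    {x y : Fin N → A} (hx : IsUniformizing K x) (hy : IsUniformizing K y)
    (m : Fin N →₀ ℕ) (p : Fin N) : FormalVF N A := fun q =>
  ∑ k ∈ Finset.Iic m,
    MvPowerSeries.C ((-1) ^ (m - k).degree * ((∏ i, (m i).choose (k i) : ℕ) : A) *
        ∏ i, x i ^ (m - k) i) *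
      ((∏ i, hy.taylor (x i) ^ k i) * hy.taylor (hx.pderiv p (y q)) -
        MvPowerSeries.C ((∏ i, x i ^ k i) * hx.pderiv p (y q)))

/-! ### Schemes over `K` -/

section Scheme

variable (K : Type u) [Field K] (X : Scheme.{u}) [X.Over (Spec (.of K))]

/-- The structure map `K → 𝒪_X(W)` of a `K`-scheme. -/
def sectionsStructureMap (W : X.Opens) : CommRingCat.of K ⟶ Γ(X, W) :=
  (Scheme.ΓSpecIso (.of K)).inv ≫ (X ↘ Spec (.of K)).appTop ≫
    X.presheaf.map (homOfLE (le_top : W ≤ ⊤)).op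

/-- The rings of regular functions on a `K`-scheme are `K`-algebras. -/
instance sectionsAlgebra (W : X.Opens) : Algebra K Γ(X, W) :=
  (sectionsStructureMap K X W).hom.toAlgebra

variable {X} in
/-- Restriction of regular functions. -/
def resFun {V W : X.Opens} (h : V ≤ W) : Γ(X, W) →+* Γ(X, V) :=
  (X.presheaf.map (homOfLE h).op).hom

/-- An étale chart of `X`: an affine open subset `U` with uniformizing parameters
`x₁, …, x_N ∈ 𝒪_X(U)`. -/
structure EtaleChart (N : ℕ) where
  U : X.Opens
  isAffineOpen : IsAffineOpen U
  x : Fin N → Γ(X, U)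
  isUniformizing : IsUniformizing K x

/-! ### Vector fields, differentials and `(1,1)`-tensors -/

/-- The vector fields on the open set `W`: the `K`-linear derivations of the sheaf `𝒪_W`. -/
def vectorFields (W : X.Opens) :
    AddSubgroup (∀ V : {V : X.Opens // V ≤ W}, Derivation K Γ(X, V.1) Γ(X, V.1)) where
  carrier := {D | ∀ (V V' : {V : X.Opens // V ≤ W}) (h : V'.1 ≤ V.1) (f : Γ(X, V.1)),
    D V' (resFun h f) = resFun h (D V f)}
  add_mem' hD hE V V' h f := by simp [hD V V' h f, hE V V' h f]
  zero_mem' V V' h f := by simp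
  neg_mem' hD V V' h f := by simp [hD V V' h f]

variable {K X}

lemma resFun_resFun {U V W : X.Opens} (h : U ≤ V) (h' : V ≤ W) (f : Γ(X, W)) :
    resFun h (resFun h' f) = resFun (h.trans h') f := by
  simp only [resFun, ← CommRingCat.comp_apply, ← Functor.map_comp, ← op_comp, homOfLE_comp]

instance vectorFieldsModule (W : X.Opens) : Module Γ(X, W) (vectorFields K X W) where
  smul a D := ⟨fun V => resFun V.2 a • D.1 V, fun V V' h f => by
    simp [D.2 V V' h f, resFun_resFun]⟩
  one_smul D := Subtype.ext <| funext fun V => by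
    change resFun V.2 1 • D.1 V = D.1 V
    simp
  mul_smul a b D := Subtype.ext <| funext fun V => by
    change resFun V.2 (a * b) • D.1 V = resFun V.2 a • resFun V.2 b • D.1 V
    simp [mul_smul]
  smul_zero a := Subtype.ext <| funext fun V => by
    change resFun V.2 a • (0 : Derivation K Γ(X, V.1) Γ(X, V.1)) = 0
    simp
  smul_add a D E := Subtype.ext <| funext fun V => by
    change resFun V.2 a • (D.1 V + E.1 V) = resFun V.2 a • D.1 V + resFun V.2 a • E.1 V
    simp
  add_smul a b D := Subtype.ext <| funext fun V => by
    change resFun V.2 (a + b) • D.1 V = resFun V.2 a • D.1 V + resFun V.2 b • D.1 V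
    simp [add_smul]
  zero_smul D := Subtype.ext <| funext fun V => by
    change resFun V.2 0 • D.1 V = 0
    simp

/-- Restriction of vector fields. -/
def resVF {V W : X.Opens} (h : V ≤ W) : vectorFields K X W →+ vectorFields K X V where
  toFun D := ⟨fun V' => D.1 ⟨V'.1, V'.2.trans h⟩, fun V₁ V₂ h' f =>
    D.2 ⟨V₁.1, V₁.2.trans h⟩ ⟨V₂.1, V₂.2.trans h⟩ h' f⟩
  map_zero' := rfl
  map_add' _ _ := rfl

lemma resVF_smul {V W : X.Opens} (h : V ≤ W) (a : Γ(X, W)) (D : vectorFields K X W) :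
    resVF h (a • D) = resFun h a • resVF h D :=
  Subtype.ext <| funext fun V' => by
    change resFun (V'.2.trans h) a • D.1 ⟨V'.1, V'.2.trans h⟩ =
      resFun V'.2 (resFun h a) • D.1 ⟨V'.1, V'.2.trans h⟩
    rw [resFun_resFun]

variable (K X)

/-- The presheaf of abelian groups underlying the sheaf of vector fields. -/
def vectorFieldsAb : X.Opensᵒᵖ ⥤ AddCommGrpCat.{u} where
  obj W := AddCommGrpCat.of (vectorFields K X W.unop)
  map i := AddCommGrpCat.ofHom (resVF i.unop.le)
  map_id _ := rfl
  map_comp _ _ := rfl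

instance vectorFieldsAbModule (W : X.Opensᵒᵖ) :
    Module ((X.presheaf ⋙ forget₂ CommRingCat RingCat).obj W) ((vectorFieldsAb K X).obj W) :=
  vectorFieldsModule W.unop

/-- The sheaf `𝒱` of vector fields on `X`, as a presheaf of modules. -/
def vectorFieldsPresheaf : PresheafOfModules.{u} (X.presheaf ⋙ forget₂ CommRingCat RingCat) :=
  PresheafOfModules.ofPresheaf (vectorFieldsAb K X) fun _ _ i r D => resVF_smul i.unop.le r D

/-- The morphism from the constant presheaf `K` to `𝒪_X`. -/
def constToStructureSheaf : (Functor.const _).obj (CommRingCat.of K) ⟶ X.presheaf where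
  app W := sectionsStructureMap K X W.unop
  naturality V W i := by
    simp only [sectionsStructureMap, Functor.const_obj_map, Category.assoc,
      ← Functor.map_comp]
    rfl

/-- The presheaf of Kähler differentials `W ↦ Ω¹_{𝒪(W)/K}`. -/
def kaehlerPresheaf : PresheafOfModules.{u} (X.presheaf ⋙ forget₂ CommRingCat RingCat) :=
  PresheafOfModules.DifferentialsConstruction.relativeDifferentials' (constToStructureSheaf K X)

/-- The presheaf `W ↦ Ω¹_{𝒪(W)/K} ⊗_{𝒪(W)} 𝒱(W)`. -/
def tensorPresheaf : PresheafOfModules.{u} (X.presheaf ⋙ forget₂ CommRingCat RingCat) :=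
  PresheafOfModules.Monoidal.tensorObj (kaehlerPresheaf K X) (vectorFieldsPresheaf K X)

/-- The sheaf `Ω¹ ⊗_{𝒪} 𝒱` of `(1,1)`-tensors on `X`. -/
def oneOneTensors : X.Modules :=
  (PresheafOfModules.sheafification (𝟙 X.ringCatSheaf.obj)).obj (tensorPresheaf K X)

/-- The section `df ⊗ D` of `Ω¹ ⊗ 𝒱`. -/
def dTensor {W : X.Opens} (f : Γ(X, W)) (D : vectorFields K X W) : Γ(oneOneTensors K X, W) :=
  (toSheafify (Opens.grothendieckTopology X) (tensorPresheaf K X).presheaf).app (op W)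
    ((CommRingCat.KaehlerDifferential.d (f := sectionsStructureMap K X W) f) ⊗ₜ[Γ(X, W)] D)

/-! ### Vector bundles with fibre `𝓛̂₊` -/

/-- A vector bundle on `X` with fibre `𝓛̂₊`, given by a sheaf of `𝒪_X`-modules (its sections) with a
trivialization over every étale chart. Over an open subset `W` of a chart, the sections of the
trivial bundle with fibre `𝓛̂₊` are the elements of `𝒪(W) ⊗̂ 𝓛̂₊`. -/
structure LPlusBundle (N : ℕ) where
  /-- The sheaf of sections. -/
  E : X.Modules
  /-- The trivializations. -/
  triv : ∀ (c : EtaleChart K X N) (W : X.Opens), W ≤ c.U →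
    (Γ(E, W) ≃ₗ[Γ(X, W)] LPlus N Γ(X, W))
  /-- The trivializations are isomorphisms of sheaves. -/
  triv_res : ∀ (c : EtaleChart K X N) (V W : X.Opens) (hV : V ≤ W) (hW : W ≤ c.U) (e : Γ(E, W))
    (j : Fin N),
    (triv c V (hV.trans hW) (E.presheaf.map (homOfLE hV).op e)).1 j =
      MvPowerSeries.map (resFun hV) ((triv c W hW e).1 j)
  /-- The transition maps are continuous for the topology of `𝒪(W) ⊗̂ 𝓛̂₊` as a space of power
  series over the discrete ring `𝒪(W)`. -/
  continuous_transition : ∀ (c₁ c₂ : EtaleChart K X N) (W : X.Opens) (h₁ : W ≤ c₁.U)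
    (h₂ : W ≤ c₂.U) (r : ℕ), ∃ s : ℕ, ∀ v : LPlus N Γ(X, W), v.1 ∈ formalVFGE N Γ(X, W) s →
      (triv c₂ W h₂ ((triv c₁ W h₁).symm v)).1 ∈ formalVFGE N Γ(X, W) r

variable {K X}

/-- The transition functions of the bundle between any two étale charts `(U₁, x)` and `(U₂, y)` are
given by the transition formula. The restrictions of `x` and of `y` to `U₁ ∩ U₂` are uniformizing
parameters there; as the transition maps are linear, continuous and compatible with restriction,
they are determined by their values on the fields `X^m ∂/∂X_p` over `U₁ ∩ U₂`. -/
def LPlusBundle.HasTransitionFormula {N : ℕ} (L : LPlusBundle K X N) : Prop :=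
  ∀ c₁ c₂ : EtaleChart K X N,
    ∃ (hx : IsUniformizing K fun i => resFun (inf_le_left : c₁.U ⊓ c₂.U ≤ c₁.U) (c₁.x i))
      (hy : IsUniformizing K fun i => resFun (inf_le_right : c₁.U ⊓ c₂.U ≤ c₂.U) (c₂.x i)),
      ∀ (m : Fin N →₀ ℕ) (hm : m ≠ 0) (p : Fin N),
        (L.triv c₂ (c₁.U ⊓ c₂.U) inf_le_right ((L.triv c₁ (c₁.U ⊓ c₂.U) inf_le_left).symm
          (LPlus.monomial Γ(X, c₁.U ⊓ c₂.U) m hm p))).1 = transitionFormula hx hy m p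

/-- `F` is the decreasing filtration of the bundle by the subbundles that correspond, in every
trivialization, to the subspaces `∏_{k ≥ r} 𝓛ₖ` of the fibre. -/
structure LPlusBundle.IsDegreeFiltration {N : ℕ} (L : LPlusBundle K X N) (F : ℕ → Subobject L.E) :
    Prop where
  antitone : Antitone F
  zero : F 0 = ⊤
  mem_iff : ∀ (r : ℕ) (c : EtaleChart K X N) (W : X.Opens) (hW : W ≤ c.U) (e : Γ(L.E, W)),
    (∃ e' : Γ((F r : X.Modules), W), (F r).arrow.app W e' = e) ↔
      (L.triv c W hW e).1 ∈ formalVFGE N Γ(X, W) r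

/-- Over every étale chart, the quotient of the bundle by the subbundle `G` is free of finite rank
`dim ⨁_{k < r} 𝓛ₖ`, the number of the fields `X^m ∂/∂X_p` with `1 ≤ |m| ≤ r`. -/
def LPlusBundle.QuotientIsVectorBundle {N : ℕ} (L : LPlusBundle K X N) (r : ℕ)
    (G : Subobject L.E) : Prop :=
  ∀ c : EtaleChart K X N, Nonempty ((cokernel G.arrow).restrict c.U.ι ≅
    (SheafOfModules.free (R := (c.U : Scheme.{u}).ringCatSheaf)
      (ULift.{u} ({m : Fin N →₀ ℕ // m ≠ 0 ∧ m.degree ≤ r} × Fin N)) : (c.U : Scheme.{u}).Modules))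

/-- The isomorphism `Φ` from the quotient of the bundle by `G` to the bundle of `(1,1)`-tensors is,
over every étale chart, the one which sends the class of a section with linear part
`∑ᵢⱼ aᵢⱼ Xᵢ ∂/∂Xⱼ` to `∑ᵢⱼ aᵢⱼ dxᵢ ⊗ ∂/∂xⱼ`. -/
def LPlusBundle.IsLinearPart {N : ℕ} (L : LPlusBundle K X N) (G : Subobject L.E)
    (Φ : cokernel G.arrow ≅ oneOneTensors K X) : Prop :=
  ∀ c : EtaleChart K X N, ∃ D : Fin N → vectorFields K X c.U,
    (∀ j, (D j).1 ⟨c.U, le_rfl⟩ = c.isUniformizing.pderiv j) ∧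
    ∀ e : Γ(L.E, c.U), Φ.hom.app c.U ((cokernel.π G.arrow).app c.U e) =
      ∑ i, ∑ j, MvPowerSeries.coeff (Finsupp.single i 1) ((L.triv c c.U le_rfl e).1 j) •
        dTensor K X (c.x i) (D j)

end Scheme
end

/-! In characteristic 0 a derivation of the domain `A` that kills uniformizing parameters is zero,
because `A` is algebraic over the polynomials in them (`derivation_eq_zero`). Hence the `∂/∂xᵢ`
commute, the chain rule holds, and Taylor expansion `T_x : A → A[[X]]` is a homomorphism of
`K`-algebras with constant term the identity. Such homomorphisms are rigid: they are determined by
their values on the parameters (`algHom_ext`). So the substitution `Xᵢ ↦ T_y(xᵢ) - xᵢ` carries `T_x`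
to `T_y` (`coordChange_taylor`), since both sides send `xᵢ` to `T_y(xᵢ)`.

The transition map is the change of formal coordinates of vector fields: substitute in the
components, then multiply by the expanded Jacobian `T_y(∂y_q/∂x_p)`. The cocycle identity follows
from `coordChange_taylor` and the chain rule. On `X^m ∂/∂X_p` the map gives `(G(y+Y) - G(y))^m
T_y(∂y_q/∂x_p)`; the binomial theorem turns this into the stated formula, whose subtracted terms add
up to a multiple of `(G(y) - G(y))^m = 0`. The substitution has no constant term, so the order of
vanishing never drops and the degree filtration is preserved. In lowest degree only the Jacobian
matrices remain, which is the rule for `(1,1)`-tensors.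

To globalize, parameters are restricted to smaller open sets by extending derivations through the
function field, and `E` is the sheaf of compatible families of coefficients over all nonempty open
sets with a chart. The quotient `E/F_r` is split over a chart by the finitely many coefficients with
`1 ≤ |m| ≤ r`. For `E/F_1`, both it and `Ω¹ ⊗ 𝒱` are identified with one sheaf of matrices. For the
tensors this is local bijectivity of a presheaf map: on an affine open subset of a chart `Ω¹` is
projective, hence free on the `dxᵢ`. -/

noncomputable section

/-! ### Derivations in uniformizing parameters and Taylor expansion. -/

namespace IsUniformizing

variable {K A : Type u} [Field K] [CharZero K] [CommRing A] [IsDomain A] [Algebra K A] {N : ℕ}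
  {x y z : Fin N → A}

/-- A derivation on `A` with values in a torsion free module is determined by its values on
uniformizing parameters. -/
lemma derivation_eq_zero (h : IsUniformizing K x) {M : Type*} [AddCommGroup M] [Module A M]
    [Module K M] [IsScalarTower K A M] [Module.IsTorsionFree A M] (D : Derivation K A M)
    (hD : ∀ i, D (x i) = 0) : D = 0 := by
  have hS : ∀ s ∈ Algebra.adjoin K (Set.range x), D s = 0 := by
    intro s hs
    induction hs using Algebra.adjoin_induction with
    | mem s hs => obtain ⟨i, rfl⟩ := hs; exact hD i
    | algebraMap r => simp
    | add a b _ _ ha hb => simp [ha, hb]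
    | mul a b _ _ ha hb => simp [ha, hb]
  -- As `D` kills the subalgebra generated by the parameters, it is linear over it and can be
  -- applied to polynomial relations with coefficients there.
  let D' : Derivation (Algebra.adjoin K (Set.range x)) A M :=
    Derivation.mk' 
      { toFun := D
        map_add' := D.map_add
        map_smul' := fun s a => by
          rw [Subalgebra.smul_def, smul_eq_mul, D.leibniz, hS s s.2, smul_zero, add_zero]
          rfl }
      (fun a b => D.leibniz a b)
  ext f
  change D' f = 0
  -- Take a relation `p(f) = 0` of least degree. Then `0 = D(p(f)) = p'(f) • D f`, and torsion
  -- freeness gives `D f = 0` once `p'(f) ≠ 0`.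
  have hex : ∃ n : ℕ, ∃ p : Polynomial (Algebra.adjoin K (Set.range x)),
      p ≠ 0 ∧ Polynomial.aeval f p = 0 ∧ p.natDegree = n := by
    obtain ⟨p, hp, hpf⟩ := h.algebraic f
    exact ⟨_, p, hp, hpf, rfl⟩
  classical
  obtain ⟨p, hp, hpf, hn⟩ := Nat.find_spec hex
  have hmin := fun m => Nat.find_min hex (m := m)
  rw [← hn] at hmin
  -- Otherwise `p'` would be a relation of smaller degree: `p` is not constant, and in
  -- characteristic 0 its derivative is then nonzero.
  have hder : Polynomial.aeval f (Polynomial.derivative p) ≠ 0 := by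
    intro h0
    have hd : p.natDegree ≠ 0 := by
      intro hd
      rw [Polynomial.eq_C_of_natDegree_eq_zero hd] at hpf hp
      simp only [Polynomial.aeval_C, ne_eq] at hpf hp
      apply hp
      rw [(FaithfulSMul.algebraMap_injective _ A) (hpf.trans (map_zero _).symm), map_zero]
    have : CharZero (Algebra.adjoin K (Set.range x)) :=
      charZero_of_injective_algebraMap (algebraMap K _).injective
    refine hmin _ (Polynomial.natDegree_derivative_lt hd)
      ⟨Polynomial.derivative p, ?_, h0, rfl⟩
    intro h1
    exact hd (Polynomial.derivative_eq_zero.1 h1)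
  have := D'.map_aeval p f
  rw [hpf, map_zero] at this
  exact (smul_eq_zero.1 this.symm).resolve_left hder

lemma derivation_ext (h : IsUniformizing K x) {M : Type*} [AddCommGroup M] [Module A M]
    [Module K M] [IsScalarTower K A M] [Module.IsTorsionFree A M] {D D' : Derivation K A M}
    (hD : ∀ i, D (x i) = D' (x i)) : D = D' :=
  sub_eq_zero.1 (h.derivation_eq_zero (D - D') fun i => by simp [hD i])

omit [CharZero K] [IsDomain A] in
lemma pderiv_param (h : IsUniformizing K x) (i j : Fin N) :
    h.pderiv i (x j) = Pi.single (M := fun _ => A) i 1 j := by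
  have := h.pderiv_aeval i (MvPolynomial.X j)
  rw [MvPolynomial.aeval_X] at this
  rw [this, MvPolynomial.pderiv_X]
  simp only [Pi.single_apply]
  split_ifs <;> simp

omit [CharZero K] [IsDomain A] in
lemma derivation_sum_apply {ι : Type*} (s : Finset ι) (D : ι → Derivation K A A) (f : A) :
    (∑ i ∈ s, D i) f = ∑ i ∈ s, D i f := by
  rw [← Derivation.coeFnAddMonoidHom_apply, map_sum, Finset.sum_apply]
  rfl

/-- Derivations are linear combinations of the `∂/∂xᵢ`. -/
lemma derivation_apply (h : IsUniformizing K x) (D : Derivation K A A) (f : A) :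
    D f = ∑ i, D (x i) * h.pderiv i f := by
  have : D = ∑ i, D (x i) • h.pderiv i := by
    apply h.derivation_ext
    intro j
    rw [derivation_sum_apply]
    simp [pderiv_param, Pi.single_apply]
  conv_lhs => rw [this]
  rw [derivation_sum_apply]
  simp

/-- The commutator is again a derivation, and it kills the parameters because their first
derivatives are constants. -/
lemma pderiv_comm (h : IsUniformizing K x) (i j : Fin N) (f : A) :
    h.pderiv i (h.pderiv j f) = h.pderiv j (h.pderiv i f) := by
  have : ⁅h.pderiv i, h.pderiv j⁆ = (0 : Derivation K A A) := by
    apply h.derivation_eq_zero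
    intro k
    rw [Derivation.commutator_apply, pderiv_param, pderiv_param]
    simp only [Pi.single_apply]
    split_ifs <;> simp
  have h2 := DFunLike.congr_fun this f
  rw [Derivation.commutator_apply] at h2
  exact sub_eq_zero.1 h2

/-- The chain rule. -/
lemma pderiv_chain (hx : IsUniformizing K x) (hy : IsUniformizing K y) (p : Fin N) (f : A) :
    hx.pderiv p f = ∑ q, hx.pderiv p (y q) * hy.pderiv q f :=
  hy.derivation_apply _ f

/-- Restriction to a larger domain commutes with the partial derivatives. -/
lemma map_pderiv {B : Type u} [CommRing B] [IsDomain B] [Algebra K B] (ρ : A →ₐ[K] B)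
    (hρ : Function.Injective ρ) {x' : Fin N → B} (hxx : ∀ i, ρ (x i) = x' i)
    (h : IsUniformizing K x) (h' : IsUniformizing K x') (i : Fin N) (f : A) : ρ (h.pderiv i f) = h'.pderiv i (ρ f) := by
  -- Viewed over `A`, both sides are derivations `A → B`; `B` is torsion free because `ρ` is
  -- injective, so comparing them on the parameters is enough.
  let _ : Algebra A B := ρ.toRingHom.toAlgebra
  have : IsScalarTower K A B := IsScalarTower.of_algebraMap_eq fun r => (ρ.commutes r).symm
  have : FaithfulSMul A B := (faithfulSMul_iff_algebraMap_injective A B).2 hρ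
  let D₁ : Derivation K A B := (Algebra.linearMap A B).compDer (h.pderiv i)
  let D₂ : Derivation K A B := (h'.pderiv i).compAlgebraMap A
  have : D₁ = D₂ := by
    apply h.derivation_ext
    intro j
    change ρ (h.pderiv i (x j)) = h'.pderiv i (ρ (x j))
    rw [hxx, pderiv_param, pderiv_param]
    simp only [Pi.single_apply]
    split_ifs <;> simp
  exact DFunLike.congr_fun this f

omit [CharZero K] [IsDomain A] in
@[simp] lemma iterPderiv_zero (h : IsUniformizing K x) (f : A) : h.iterPderiv 0 f = f := by
  simp only [iterPderiv, Finsupp.coe_zero, Pi.zero_apply, pow_zero]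
  rw [List.prod_eq_one (by simp)]
  rfl

/-- The iterated derivative is a product in a fixed order. Commutativity moves the additional factor
to the right end, by induction on lists without repetition. -/
lemma iterPderiv_add_single (h : IsUniformizing K x) (m : Fin N →₀ ℕ) (i : Fin N) (f : A) :
    h.iterPderiv (m + Finsupp.single i 1) f = h.iterPderiv m (h.pderiv i f) := by
  have hc : ∀ i j, Commute (h.pderiv i : A →ₗ[K] A) (h.pderiv j : A →ₗ[K] A) := fun i j =>
    LinearMap.ext fun f => h.pderiv_comm i j f
  have key : ∀ l : List (Fin N), l.Nodup →
      ((l.map fun j => ((h.pderiv j : A →ₗ[K] A) ^ (m + Finsupp.single i 1 : Fin N →₀ ℕ) j :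
        Module.End K A)).prod =
      (l.map fun j => ((h.pderiv j : A →ₗ[K] A) ^ m j : Module.End K A)).prod *
        (if i ∈ l then (h.pderiv i : A →ₗ[K] A) else 1 : Module.End K A)) := by
    intro l
    induction l with
    | nil => simp
    | cons a l ih =>
      intro hl
      rw [List.nodup_cons] at hl
      rw [List.map_cons, List.prod_cons, List.map_cons, List.prod_cons, ih hl.2]
      by_cases hia : i = a
      · subst hia
        have hcomm : Commute (l.map fun j => ((h.pderiv j : A →ₗ[K] A) ^ m j :
            Module.End K A)).prod (h.pderiv i : A →ₗ[K] A) :=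
          Commute.list_prod_left _ _ fun b hb => by
            obtain ⟨j, -, rfl⟩ := List.mem_map.1 hb
            exact (hc j i).pow_left _
        simp only [hl.1, List.mem_cons, true_or, if_true, if_false, mul_one]
        rw [mul_assoc, hcomm.eq, ← mul_assoc]
        simp [pow_succ]
      · have : (m + Finsupp.single i 1 : Fin N →₀ ℕ) a = m a := by simp [hia]
        simp only [List.mem_cons, hia, false_or, this, mul_assoc]
  have := key (List.finRange N) (List.nodup_finRange N)
  simp only [List.mem_finRange, if_true] at this
  rw [iterPderiv, this]
  rfl

omit [CharZero K] [IsDomain A] in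
lemma coeff_taylor (h : IsUniformizing K x) (m : Fin N →₀ ℕ) (f : A) :
    MvPowerSeries.coeff m (h.taylor f) =
      ((∏ i, (m i).factorial : ℕ) : K)⁻¹ • h.iterPderiv m f := rfl

omit [CharZero K] [IsDomain A] in
@[simp] lemma constantCoeff_taylor (h : IsUniformizing K x) (f : A) :
    MvPowerSeries.constantCoeff (h.taylor f) = f := by
  rw [← MvPowerSeries.coeff_zero_eq_constantCoeff_apply, coeff_taylor]
  simp

/-- The factor `mᵢ + 1` from formal differentiation cancels against the factorials. This lets
identities between Taylor series be proved by induction on the degree. -/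
lemma pderiv_taylor (h : IsUniformizing K x) (i : Fin N) (f : A) :
    MvPowerSeries.pderiv A i (h.taylor f) = h.taylor (h.pderiv i f) := by
  ext m
  rw [MvPowerSeries.coeff_pderiv, coeff_taylor, coeff_taylor, iterPderiv_add_single]
  have h1 : (∏ j, ((m + Finsupp.single i 1 : Fin N →₀ ℕ) j).factorial) = (m i + 1) * ∏ j, (m j).factorial := by
    rw [← Finset.mul_prod_erase _ _ (Finset.mem_univ i),
      ← Finset.mul_prod_erase _ (fun j => (m j).factorial) (Finset.mem_univ i), ← mul_assoc]
    congr 1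
    · simp [Nat.factorial_succ]
    · refine Finset.prod_congr rfl fun j hj => ?_
      simp [(Finset.ne_of_mem_erase hj).symm]
  have h2 : ((m i : A) + 1) = algebraMap K A ((m i + 1 : ℕ) : K) := by simp
  rw [h1, h2, mul_comm, ← Algebra.smul_def, smul_smul]
  congr 1
  push_cast
  have : ((m i : K) + 1) ≠ 0 := by exact_mod_cast Nat.succ_ne_zero (m i)
  field_simp

end IsUniformizing

/-- Two power series agree in a degree if their derivatives agree in the degree below. -/
lemma MvPowerSeries.coeff_eq_of_pderiv {A σ : Type*} [CommRing A] [IsAddTorsionFree A]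
    {f g : MvPowerSeries σ A} {m : σ →₀ ℕ} (i : σ)
    (h : coeff m (pderiv A i f) = coeff m (pderiv A i g)) :
    coeff (m + Finsupp.single i 1) f = coeff (m + Finsupp.single i 1) g := by
  rw [coeff_pderiv, coeff_pderiv] at h
  have h3 : (m i + 1) • coeff (m + Finsupp.single i 1) f =
      (m i + 1) • coeff (m + Finsupp.single i 1) g := by
    simpa [nsmul_eq_mul, mul_comm] using h
  exact (smul_right_inj (Nat.succ_ne_zero _)).1 h3

lemma isAddTorsionFree_of_algebra (K A : Type*) [Field K] [CharZero K] [Ring A] [Algebra K A] :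
    IsAddTorsionFree A := by
  let _ : Module ℚ A := Module.compHom A (algebraMap ℚ K)
  exact IsAddTorsionFree.of_module_rat A

lemma Finsupp.exists_eq_add_single {σ : Type*} {m : σ →₀ ℕ} (hm : m ≠ 0) :
    ∃ (i : σ) (n : σ →₀ ℕ), m = n + Finsupp.single i 1 := by
  obtain ⟨i, hi⟩ := Finsupp.ne_iff.1 hm
  refine ⟨i, m - Finsupp.single i 1, (tsub_add_cancel_of_le ?_).symm⟩
  rw [Finsupp.single_le_iff]
  exact Nat.one_le_iff_ne_zero.2 hi

/-- All other splittings of `m` involve a coefficient of `g` in smaller degree. This isolates the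
lowest order behaviour of products. -/
lemma MvPowerSeries.coeff_mul_of_forall_lt {A σ : Type*} [CommRing A] (f g : MvPowerSeries σ A)
    (m : σ →₀ ℕ) (hg : ∀ n : σ →₀ ℕ, n.degree < m.degree → coeff n g = 0) :
    coeff m (f * g) = constantCoeff f * coeff m g := by
  classical
  rw [coeff_mul, Finset.sum_eq_single (0, m)]
  · simp
  · rintro ⟨a, b⟩ hab hne
    replace hab : a + b = m :=
      Finset.HasAntidiagonal.mem_antidiagonal.1 hab
    have ha : a ≠ 0 := by
      rintro rfl
      rw [zero_add] at hab
      simp [hab] at hne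
    have : b.degree < m.degree := by
      rw [← hab, map_add]
      have : a.degree ≠ 0 := by rwa [Ne, Finsupp.degree_eq_zero_iff]
      omega
    simp [hg b this]
  · simp

namespace IsUniformizing

variable {K A : Type u} [Field K] [CharZero K] [CommRing A] [IsDomain A] [Algebra K A] {N : ℕ}
  {x y z : Fin N → A}

omit [CharZero K] [IsDomain A] in
lemma taylor_add (h : IsUniformizing K x) (f g : A) :
    h.taylor (f + g) = h.taylor f + h.taylor g := by
  ext m
  simp [coeff_taylor]

omit [CharZero K] [IsDomain A] in
lemma taylor_smul (h : IsUniformizing K x) (r : K) (f : A) :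
    h.taylor (r • f) = r • h.taylor f := by
  ext m
  change _ = r • MvPowerSeries.coeff m (h.taylor f)
  simp only [coeff_taylor, map_smul]
  rw [smul_comm]

/-- Differentiating both sides gives, by the Leibniz rule, the same statement for other pairs of
functions in degree one less. The induction therefore runs over all `f` and `g` at once. -/
lemma taylor_mul (h : IsUniformizing K x) (f g : A) :
    h.taylor (f * g) = h.taylor f * h.taylor g := by
  have := isAddTorsionFree_of_algebra K A
  have key : ∀ (n : ℕ) (m : Fin N →₀ ℕ), m.degree = n → ∀ f g : A,
      MvPowerSeries.coeff m (h.taylor (f * g)) =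
        MvPowerSeries.coeff m (h.taylor f * h.taylor g) := by
    intro n
    induction n with
    | zero =>
      intro m hm f g
      rw [Finsupp.degree_eq_zero_iff] at hm
      subst hm
      simp
    | succ n ih =>
      intro m hm f g
      obtain ⟨i, k, rfl⟩ := Finsupp.exists_eq_add_single (m := m) (by rintro rfl; simp at hm)
      apply MvPowerSeries.coeff_eq_of_pderiv
      have hk : k.degree = n := by simpa using hm
      rw [pderiv_taylor, Derivation.leibniz, Derivation.leibniz, taylor_add, map_add, map_add,
        pderiv_taylor, pderiv_taylor]
      simp only [smul_eq_mul]
      rw [ih k hk, ih k hk]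
  ext m
  exact key _ m rfl f g

lemma taylor_one (h : IsUniformizing K x) : h.taylor 1 = 1 := by
  have := isAddTorsionFree_of_algebra K A
  apply MvPowerSeries.pderiv.ext
  · intro i
    rw [pderiv_taylor]
    simp only [Derivation.map_one_eq_zero]
    simpa using h.taylor_smul 0 0
  · simp

/-- Taylor expansion is a homomorphism of `K`-algebras. -/
def taylorHom (h : IsUniformizing K x) : A →ₐ[K] MvPowerSeries (Fin N) A :=
  AlgHom.ofLinearMap ⟨⟨h.taylor, h.taylor_add⟩, h.taylor_smul⟩ h.taylor_one h.taylor_mul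

lemma taylor_param (h : IsUniformizing K x) (i : Fin N) :
    h.taylor (x i) = MvPowerSeries.C (x i) + MvPowerSeries.X i := by
  have := isAddTorsionFree_of_algebra K A
  apply MvPowerSeries.pderiv.ext
  · intro j
    rw [pderiv_taylor, pderiv_param, map_add, MvPowerSeries.pderiv_C, MvPowerSeries.pderiv_X]
    simp only [Pi.single_apply]
    split_ifs
    · simp [taylor_one]
    · simpa using h.taylor_smul 0 0
  · simp

end IsUniformizing
end

/-! ### Changes of formal coordinates and of formal vector fields. -/

noncomputable section

/-- The binomial theorem for multi-indices. The transition formula needs it twice: over the power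
series ring for the main term, and over `A` for the subtracted constants. -/
lemma Finset.prod_add_pow_eq_sum_Iic {R : Type*} [CommRing R] {N : ℕ} (a b : Fin N → R)
    (m : Fin N →₀ ℕ) :
    ∏ i, (a i + b i) ^ m i = ∑ k ∈ Finset.Iic m,
      ((∏ i, (m i).choose (k i) : ℕ) : R) * (∏ i, b i ^ (m - k) i) * ∏ i, a i ^ k i := by
  classical
  simp only [add_pow, Finset.prod_univ_sum]
  refine (Finset.sum_bij' (fun k _ => Finsupp.equivFunOnFinite k)
    (fun k _ => Finsupp.equivFunOnFinite.symm k) ?_ ?_ ?_ ?_ ?_).symm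
  · intro k hk
    rw [Finset.mem_Iic] at hk
    simp only [Fintype.mem_piFinset, Finset.mem_range]
    exact fun i => Nat.lt_succ_of_le (hk i)
  · intro k hk
    simp only [Fintype.mem_piFinset, Finset.mem_range] at hk
    rw [Finset.mem_Iic]
    exact fun i => Nat.le_of_lt_succ (hk i)
  · intro k _
    simp
  · intro k _
    simp
  · intro k _
    push_cast
    rw [← Finset.prod_mul_distrib, ← Finset.prod_mul_distrib]
    refine Finset.prod_congr rfl fun i _ => ?_
    simp only [Pi.sub_apply, Finsupp.equivFunOnFinite_apply]
    ring

namespace IsUniformizing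

variable {K A : Type u} [Field K] [CharZero K] [CommRing A] [IsDomain A] [Algebra K A] {N : ℕ}
  {x y z : Fin N → A}

/-- A homomorphism of `K`-algebras to a power series ring over `A`, with constant terms the
identity, is determined by its values on uniformizing parameters. -/
lemma algHom_ext {σ : Type*} (h : IsUniformizing K x) {P Q : A →ₐ[K] MvPowerSeries σ A}
    (hP : ∀ f, MvPowerSeries.constantCoeff (P f) = f)
    (hQ : ∀ f, MvPowerSeries.constantCoeff (Q f) = f) (hx : ∀ i, P (x i) = Q (x i)) : P = Q := by
  have key : ∀ (n : ℕ) (m : σ →₀ ℕ), m.degree = n → ∀ f,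
      MvPowerSeries.coeff m (P f - Q f) = 0 := by
    intro n
    induction n using Nat.strong_induction_on with
    | _ n ih =>
      intro m hm
      have hlow : ∀ f, ∀ k : σ →₀ ℕ, k.degree < m.degree →
          MvPowerSeries.coeff k (P f - Q f) = 0 := fun f k hk => ih _ (hm ▸ hk) k rfl f
      -- In the first degree where `P` and `Q` could differ, the coefficient of `P f - Q f` is a
      -- derivation in `f`: only the constant terms of `P f` and `Q g` enter the Leibniz rule, and
      -- these are `f` and `g`.
      let D : Derivation K A A := Derivation.mk'
        { toFun := fun f => MvPowerSeries.coeff m (P f - Q f)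
          map_add' := fun f g => by
            simp only [map_add, map_sub]
            ring
          map_smul' := fun r f => by
            simp only [map_smul, ← smul_sub]
            rfl }
        (fun f g => by
          change MvPowerSeries.coeff m (P (f * g) - Q (f * g)) =
            f * MvPowerSeries.coeff m (P g - Q g) + g * MvPowerSeries.coeff m (P f - Q f)
          have : P (f * g) - Q (f * g) = P f * (P g - Q g) + Q g * (P f - Q f) := by
            rw [map_mul, map_mul]
            ring
          rw [this, map_add, MvPowerSeries.coeff_mul_of_forall_lt _ _ _ (hlow g),
            MvPowerSeries.coeff_mul_of_forall_lt _ _ _ (hlow f), hP, hQ])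
      have hD : D = 0 := h.derivation_eq_zero D fun i => by
        change MvPowerSeries.coeff m (P (x i) - Q (x i)) = 0
        rw [hx, sub_self, map_zero]
      exact fun f => DFunLike.congr_fun hD f
  ext f m
  have := key _ m rfl f
  rwa [map_sub, sub_eq_zero] at this

omit [CharZero K] [IsDomain A] in
lemma hasSubst_taylor_sub (hy : IsUniformizing K y) (x : Fin N → A) :
    MvPowerSeries.HasSubst fun i => hy.taylor (x i) - MvPowerSeries.C (x i) :=
  MvPowerSeries.hasSubst_of_constantCoeff_zero fun i => by simp

/-- The change of formal coordinates `X ↦ x(y + Y) - x(y)`. -/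
def coordChange (hy : IsUniformizing K y) (x : Fin N → A) :
    MvPowerSeries (Fin N) A →ₐ[A] MvPowerSeries (Fin N) A :=
  MvPowerSeries.substAlgHom (hy.hasSubst_taylor_sub x)

omit [CharZero K] [IsDomain A] in
lemma coordChange_apply (hy : IsUniformizing K y) (x : Fin N → A) (f : MvPowerSeries (Fin N) A) :
    hy.coordChange x f = f.subst fun i => hy.taylor (x i) - MvPowerSeries.C (x i) := by
  rw [coordChange, MvPowerSeries.coe_substAlgHom]

omit [CharZero K] [IsDomain A] in
@[simp] lemma coordChange_C (hy : IsUniformizing K y) (x : Fin N → A) (a : A) :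
    hy.coordChange x (MvPowerSeries.C a) = MvPowerSeries.C a :=
  (hy.coordChange x).commutes a

omit [CharZero K] [IsDomain A] in
@[simp] lemma coordChange_X (hy : IsUniformizing K y) (x : Fin N → A) (i : Fin N) :
    hy.coordChange x (MvPowerSeries.X i) = hy.taylor (x i) - MvPowerSeries.C (x i) :=
  MvPowerSeries.substAlgHom_X _ i

omit [CharZero K] [IsDomain A] in
lemma constantCoeff_coordChange (hy : IsUniformizing K y) (x : Fin N → A)
    (f : MvPowerSeries (Fin N) A) :
    MvPowerSeries.constantCoeff (hy.coordChange x f) = MvPowerSeries.constantCoeff f := by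
  have h0 : MvPowerSeries.constantCoeff (hy.coordChange x
      (f - MvPowerSeries.C (MvPowerSeries.constantCoeff f))) = 0 := by
    rw [coordChange_apply]
    exact MvPowerSeries.constantCoeff_subst_eq_zero (hy.hasSubst_taylor_sub x)
      (fun i => by simp) (by simp)
  rw [map_sub, coordChange_C, map_sub, MvPowerSeries.constantCoeff_C, sub_eq_zero] at h0
  exact h0

omit [CharZero K] [IsDomain A] in
/-- Changes of formal coordinates do not lower the order of vanishing. -/
lemma coeff_coordChange_eq_zero (hy : IsUniformizing K y) (x : Fin N → A) {r : ℕ}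
    {f : MvPowerSeries (Fin N) A}
    (hf : ∀ m : Fin N →₀ ℕ, m.degree ≤ r → MvPowerSeries.coeff m f = 0)
    (m : Fin N →₀ ℕ) (hm : m.degree ≤ r) :
    MvPowerSeries.coeff m (hy.coordChange x f) = 0 := by
  apply MvPowerSeries.coeff_of_lt_order
  have h1 : ((r + 1 : ℕ) : ℕ∞) ≤ f.order :=
    MvPowerSeries.nat_le_order fun d hd => hf d (Nat.lt_succ_iff.1 hd)
  have h2 : 1 ≤ ⨅ i, (hy.taylor (x i) - MvPowerSeries.C (x i)).order := by
    refine le_iInf fun i => ?_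
    rw [Order.one_le_iff_ne_zero, MvPowerSeries.order_ne_zero_iff_constCoeff_eq_zero]
    simp
  rw [coordChange_apply]
  refine lt_of_lt_of_le ?_ (MvPowerSeries.le_order_subst (hy.hasSubst_taylor_sub x) f)
  refine lt_of_lt_of_le ?_ (le_mul_of_one_le_left zero_le h2)
  exact lt_of_lt_of_le (by exact_mod_cast Nat.lt_succ_of_le hm) h1

/-- Both sides are homomorphisms of `K`-algebras in `f` with constant term `f`, and on `xᵢ = T_x(xᵢ)
- Xᵢ` they agree by the choice of the substitution. Rigidity (`algHom_ext`) does the rest. -/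
lemma coordChange_taylor (hx : IsUniformizing K x) (hy : IsUniformizing K y) (f : A) :
    hy.coordChange x (hx.taylor f) = hy.taylor f := by
  have : ((hy.coordChange x).restrictScalars K).comp hx.taylorHom = hy.taylorHom := by
    apply hx.algHom_ext
    · intro f
      exact (hy.constantCoeff_coordChange x _).trans (hx.constantCoeff_taylor f)
    · exact hy.constantCoeff_taylor
    · intro i
      change hy.coordChange x (hx.taylor (x i)) = hy.taylor (x i)
      rw [taylor_param, map_add, coordChange_C, coordChange_X]
      ring
  exact DFunLike.congr_fun this f

/-- The composite sends `Xᵢ` to the image of `T_y(xᵢ) - xᵢ`, which is `T_z(xᵢ) - xᵢ` by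
`coordChange_taylor`. -/
lemma coordChange_coordChange (hy : IsUniformizing K y) (hz : IsUniformizing K z) (x : Fin N → A)
    (f : MvPowerSeries (Fin N) A) :
    hz.coordChange y (hy.coordChange x f) = hz.coordChange x f := by
  simp only [coordChange_apply]
  rw [MvPowerSeries.subst_comp_subst_apply (hy.hasSubst_taylor_sub x) (hz.hasSubst_taylor_sub y)]
  congr 1
  ext1 i
  rw [← coordChange_apply, map_sub, coordChange_C, coordChange_taylor]

lemma coordChange_self (hx : IsUniformizing K x) (f : MvPowerSeries (Fin N) A) :
    hx.coordChange x f = f := by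
  rw [coordChange_apply]
  have : (fun i => hx.taylor (x i) - MvPowerSeries.C (x i)) = MvPowerSeries.X := by
    ext1 i
    rw [taylor_param]
    ring
  rw [this, MvPowerSeries.subst_self]
  rfl

/-- The coefficients in degree `1` after a change of formal coordinates. -/
lemma coeff_single_coordChange (hy : IsUniformizing K y) (x : Fin N → A)
    {f : MvPowerSeries (Fin N) A} (hf : MvPowerSeries.constantCoeff f = 0) (k : Fin N) :
    MvPowerSeries.coeff (Finsupp.single k 1) (hy.coordChange x f) =
      ∑ i, MvPowerSeries.coeff (Finsupp.single i 1) f * hy.pderiv k (x i) := by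
  classical
  -- Removing the linear part leaves a series of order at least 2. The substitution keeps this
  -- order, so only the linear part contributes in degree 1.
  set g := f - ∑ i, MvPowerSeries.C (MvPowerSeries.coeff (Finsupp.single i 1) f) *
    MvPowerSeries.X i with hg
  have hsum : ∀ k : Fin N, MvPowerSeries.coeff (Finsupp.single k 1)
      (∑ i, MvPowerSeries.C (MvPowerSeries.coeff (Finsupp.single i 1) f) *
        MvPowerSeries.X i) = MvPowerSeries.coeff (Finsupp.single k 1) f := by
    intro k
    rw [map_sum, Finset.sum_eq_single k]
    · simp
    · intro b _ hb
      rw [MvPowerSeries.coeff_C_mul, MvPowerSeries.coeff_X, if_neg, mul_zero]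
      intro h
      exact hb (Finsupp.single_left_injective one_ne_zero h).symm
    · simp
  have hg0 : ∀ m : Fin N →₀ ℕ, m.degree ≤ 1 → MvPowerSeries.coeff m g = 0 := by
    intro m hm
    rcases Nat.le_one_iff_eq_zero_or_eq_one.1 hm with h | h
    · rw [Finsupp.degree_eq_zero_iff] at h
      subst h
      simp [hg, hf]
    · obtain ⟨i, n, rfl⟩ := Finsupp.exists_eq_add_single (m := m) (by rintro rfl; simp at h)
      have hn : n = 0 := by
        rw [← Finsupp.degree_eq_zero_iff]
        simpa using h
      subst hn
      rw [zero_add, hg, map_sub, hsum, sub_self]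
  have h1 := hy.coeff_coordChange_eq_zero x hg0 (Finsupp.single k 1) (by simp)
  have htaylor : ∀ f : A, MvPowerSeries.coeff (Finsupp.single k 1) (hy.taylor f) =
      hy.pderiv k f := by
    intro f
    have h2 := hy.pderiv_taylor k f
    have h3 := congrArg MvPowerSeries.constantCoeff h2
    rw [constantCoeff_taylor, ← MvPowerSeries.coeff_zero_eq_constantCoeff_apply,
      MvPowerSeries.coeff_pderiv] at h3
    simpa using h3
  rw [hg, map_sub, map_sub, sub_eq_zero] at h1
  rw [h1, map_sum, map_sum]
  refine Finset.sum_congr rfl fun i _ => ?_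
  rw [map_mul, coordChange_C, coordChange_X, MvPowerSeries.coeff_C_mul, map_sub, htaylor,
    MvPowerSeries.coeff_C, if_neg, sub_zero]
  simp

/-- The transition map between formal vector fields in two systems of uniformizing parameters:
the change of formal coordinates of vector fields. -/
def transition (hx : IsUniformizing K x) (hy : IsUniformizing K y) :
    FormalVF N A →ₗ[A] FormalVF N A where
  toFun v q := ∑ p, hy.coordChange x (v p) * hy.taylor (hx.pderiv p (y q))
  map_add' v w := by
    ext1 q
    simp [add_mul, Finset.sum_add_distrib]
  map_smul' a v := by
    ext1 q
    simp [Finset.smul_sum]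

omit [CharZero K] [IsDomain A] in
lemma transition_apply (hx : IsUniformizing K x) (hy : IsUniformizing K y) (v : FormalVF N A)
    (q : Fin N) :
    hx.transition hy v q = ∑ p, hy.coordChange x (v p) * hy.taylor (hx.pderiv p (y q)) := rfl

lemma taylor_sum (hy : IsUniformizing K y) {ι : Type*} (s : Finset ι) (f : ι → A) :
    hy.taylor (∑ i ∈ s, f i) = ∑ i ∈ s, hy.taylor (f i) :=
  map_sum hy.taylorHom f s

/-- The second substitution turns the Jacobian factors `T_y(∂y_q/∂x_p)` into `T_z(∂y_q/∂x_p)`;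
summing over `q` is the chain rule under the multiplicative map `T_z`. -/
lemma transition_transition (hx : IsUniformizing K x) (hy : IsUniformizing K y)
    (hz : IsUniformizing K z) (v : FormalVF N A) :
    hy.transition hz (hx.transition hy v) = hx.transition hz v := by
  ext1 r
  simp only [transition_apply, map_sum, map_mul, coordChange_coordChange, coordChange_taylor]
  simp only [Finset.sum_mul]
  rw [Finset.sum_comm]
  refine Finset.sum_congr rfl fun p _ => ?_
  rw [hx.pderiv_chain hy p (z r), taylor_sum, Finset.mul_sum]
  refine Finset.sum_congr rfl fun q _ => ?_
  rw [taylor_mul, mul_assoc]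

lemma transition_self (hx : IsUniformizing K x) (v : FormalVF N A) : hx.transition hx v = v := by
  ext1 q
  rw [transition_apply, Finset.sum_eq_single q]
  · simp [coordChange_self, pderiv_param, taylor_one]
  · intro p _ hp
    have : hx.taylor 0 = 0 := map_zero hx.taylorHom
    simp [pderiv_param, hp.symm, this]
  · simp

omit [CharZero K] [IsDomain A] in
-- Neither the substitution nor multiplication by a power series lowers the order of vanishing.
lemma transition_mem (hx : IsUniformizing K x) (hy : IsUniformizing K y) {r : ℕ}
    {v : FormalVF N A} (hv : v ∈ formalVFGE N A r) :
    hx.transition hy v ∈ formalVFGE N A r := by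
  classical
  intro q m hm
  rw [transition_apply, map_sum]
  refine Finset.sum_eq_zero fun p _ => ?_
  rw [MvPowerSeries.coeff_mul]
  refine Finset.sum_eq_zero fun ab hab => ?_
  replace hab : ab.1 + ab.2 = m := Finset.HasAntidiagonal.mem_antidiagonal.1 hab
  rw [hy.coeff_coordChange_eq_zero x (hv p), zero_mul]
  rw [← hab, map_add] at hm
  omega

/-- The linear part of a vector field transforms like a tensor of type `(1,1)`. -/
lemma coeff_single_transition (hx : IsUniformizing K x) (hy : IsUniformizing K y)
    {v : FormalVF N A} (hv : v ∈ formalVFGE N A 0) (k l : Fin N) :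
    MvPowerSeries.coeff (Finsupp.single k 1) (hx.transition hy v l) =
      ∑ j, ∑ i, MvPowerSeries.coeff (Finsupp.single i 1) (v j) * hy.pderiv k (x i) *
        hx.pderiv j (y l) := by
  rw [transition_apply, map_sum]
  refine Finset.sum_congr rfl fun j _ => ?_
  have h0 : MvPowerSeries.constantCoeff (v j) = 0 := hv j 0 (by simp)
  rw [mul_comm, MvPowerSeries.coeff_mul_of_forall_lt, constantCoeff_taylor,
    hy.coeff_single_coordChange x h0, mul_comm, Finset.sum_mul]
  intro n hn
  have : n = 0 := by
    rw [← Finsupp.degree_eq_zero_iff]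
    simpa using hn
  subst this
  exact (hy.constantCoeff_coordChange x _).trans h0

omit [CharZero K] in
-- The image of the monomial field is `(T_y(x) - x)^m` times the Jacobian factor. The formula is its
-- binomial expansion, together with constants that cancel.
lemma transition_monomial (hx : IsUniformizing K x) (hy : IsUniformizing K y)
    (m : Fin N →₀ ℕ) (hm : m ≠ 0) (p : Fin N) :
    hx.transition hy (LPlus.monomial A m hm p).1 = transitionFormula hx hy m p := by
  have hdeg : ∀ k : Fin N →₀ ℕ, ∀ R : Type u, ∀ [CommRing R],
      ((-1 : R) ^ k.degree) = ∏ i, (-1) ^ k i := by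
    intro k R _
    rw [Finset.prod_pow_eq_pow_sum, Finsupp.degree_eq_sum]
  have hneg : ∀ (R : Type u) [CommRing R] (b : Fin N → R) (k : Fin N →₀ ℕ),
      ∏ i, (-b i) ^ k i = (-1) ^ k.degree * ∏ i, b i ^ k i := by
    intro R _ b k
    rw [hdeg, ← Finset.prod_mul_distrib]
    exact Finset.prod_congr rfl fun i _ => neg_pow _ _
  ext1 q
  have hL : hx.transition hy (LPlus.monomial A m hm p).1 q =
      (∏ i, (hy.taylor (x i) + -MvPowerSeries.C (x i)) ^ m i) * hy.taylor (hx.pderiv p (y q)) := by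
    rw [transition_apply, Finset.sum_eq_single p]
    · congr 1
      simp only [LPlus.monomial, Pi.single_eq_same, coordChange]
      rw [MvPowerSeries.substAlgHom_monomial, map_one, one_mul, Finsupp.prod_fintype _ _
        (fun _ => pow_zero _)]
      simp only [sub_eq_add_neg]
    · intro j _ hj
      simp [LPlus.monomial, hj]
    · simp
  -- The subtracted terms assemble to `∏ᵢ (xᵢ - xᵢ)^{mᵢ}`, which vanishes exactly because `m ≠ 0`.
  have h0 : ∑ k ∈ Finset.Iic m, ((∏ i, (m i).choose (k i) : ℕ) : A) *
      (∏ i, (-x i) ^ (m - k) i) * ∏ i, x i ^ k i = 0 := by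
    rw [← Finset.prod_add_pow_eq_sum_Iic]
    obtain ⟨i, hi⟩ := Finsupp.ne_iff.1 hm
    apply Finset.prod_eq_zero (Finset.mem_univ i)
    rw [add_neg_cancel, zero_pow hi]
  have hR : transitionFormula hx hy m p q =
      (∑ k ∈ Finset.Iic m, ((∏ i, (m i).choose (k i) : ℕ) : MvPowerSeries (Fin N) A) *
        (∏ i, (-MvPowerSeries.C (x i)) ^ (m - k) i) * ∏ i, hy.taylor (x i) ^ k i) *
          hy.taylor (hx.pderiv p (y q)) -
      MvPowerSeries.C (∑ k ∈ Finset.Iic m, ((∏ i, (m i).choose (k i) : ℕ) : A) *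
        (∏ i, (-x i) ^ (m - k) i) * ∏ i, x i ^ k i) *
          MvPowerSeries.C (hx.pderiv p (y q)) := by
    rw [map_sum, Finset.sum_mul, Finset.sum_mul, ← Finset.sum_sub_distrib, transitionFormula]
    refine Finset.sum_congr rfl fun k _ => ?_
    rw [hneg, hneg]
    simp only [map_mul, map_pow, map_neg, map_one, map_natCast, map_prod]
    ring
  rw [hL, hR, h0, map_zero, zero_mul, sub_zero, Finset.prod_add_pow_eq_sum_Iic]

lemma map_taylor {B : Type u} [CommRing B] [IsDomain B] [Algebra K B] (ρ : A →ₐ[K] B)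
    (hρ : Function.Injective ρ) {x' : Fin N → B} (hxx : ∀ i, ρ (x i) = x' i)
    (h : IsUniformizing K x) (h' : IsUniformizing K x') (f : A) : MvPowerSeries.map (ρ : A →+* B) (h.taylor f) = h'.taylor (ρ f) := by
  ext m
  rw [MvPowerSeries.coeff_map, coeff_taylor, coeff_taylor]
  change ρ _ = _
  rw [map_smul]
  congr 1
  simp only [iterPderiv]
  have hpow : ∀ (i : Fin N) (n : ℕ) (f : A), ρ (((h.pderiv i : A →ₗ[K] A) ^ n : Module.End K A) f) =
      ((h'.pderiv i : B →ₗ[K] B) ^ n : Module.End K B) (ρ f) := by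
    intro i n
    induction n with
    | zero => intro f; rfl
    | succ n ih =>
      intro f
      rw [pow_succ, pow_succ]
      change ρ (((h.pderiv i : A →ₗ[K] A) ^ n : Module.End K A) (h.pderiv i f)) =
        ((h'.pderiv i : B →ₗ[K] B) ^ n : Module.End K B) (h'.pderiv i (ρ f))
      rw [ih, map_pderiv ρ hρ hxx h h']
  induction List.finRange N generalizing f with
  | nil => rfl
  | cons a l ih =>
    rw [List.map_cons, List.prod_cons, List.map_cons, List.prod_cons]
    exact (hpow _ _ _).trans (congrArg _ (ih f))

/-- Taylor series, partial derivatives and substitutions all commute with `ρ`. With `ρ` a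
restriction, this makes the transition maps morphisms of sheaves. -/
lemma map_transition {B : Type u} [CommRing B] [IsDomain B] [Algebra K B] (ρ : A →ₐ[K] B)
    (hρ : Function.Injective ρ) {x' y' : Fin N → B} (hxx : ∀ i, ρ (x i) = x' i)
    (hyy : ∀ i, ρ (y i) = y' i) (hx : IsUniformizing K x) (hx' : IsUniformizing K x')
    (hy : IsUniformizing K y) (hy' : IsUniformizing K y') (v : FormalVF N A) (q : Fin N) :
    MvPowerSeries.map (ρ : A →+* B) (hx.transition hy v q) =
      hx'.transition hy' (fun j => MvPowerSeries.map (ρ : A →+* B) (v j)) q := by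
  simp only [transition_apply, map_sum, map_mul]
  refine Finset.sum_congr rfl fun p _ => ?_
  congr 1
  · rw [coordChange_apply, coordChange_apply,
      MvPowerSeries.map_subst (hy.hasSubst_taylor_sub x)]
    congr 1
    ext1 i
    rw [map_sub, map_taylor ρ hρ hyy hy hy', MvPowerSeries.map_C, hxx]
    rw [← hxx]
    rfl
  · rw [map_taylor ρ hρ hyy hy hy', map_pderiv ρ hρ hxx hx hx', hyy]

end IsUniformizing
end

/-! ### Uniformizing parameters and Kähler differentials. -/

noncomputable section

section KaehlerBasis

open scoped KaehlerDifferential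

variable {K A : Type u} [Field K] [CharZero K] [CommRing A] [Algebra K A] {N : ℕ} {x : Fin N → A}

omit [CharZero K] in
/-- Coordinates with respect to a basis of exact differentials are partial derivatives. -/
lemma coord_aeval_of_basis (b : Module.Basis (Fin N) A Ω[A⁄K])
    (hb : ∀ i, b i = KaehlerDifferential.D K A (x i)) (i : Fin N) (p : MvPolynomial (Fin N) K) :
    (b.coord i).compDer (KaehlerDifferential.D K A) (MvPolynomial.aeval x p) =
      MvPolynomial.aeval x (MvPolynomial.pderiv i p) := by
  classical
  induction p using MvPolynomial.induction_on with
  | C r => simp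
  | add p q hp hq => rw [map_add, map_add, hp, hq, map_add, map_add]
  | mul_X p j hp =>
    rw [map_mul, Derivation.leibniz, hp, Derivation.leibniz, map_add, MvPolynomial.aeval_X,
      MvPolynomial.pderiv_X]
    have : (b.coord i).compDer (KaehlerDifferential.D K A) (x j) =
        Pi.single (M := fun _ => A) i 1 j := by
      change b.coord i (KaehlerDifferential.D K A (x j)) = _
      rw [← hb, Module.Basis.coord_apply, Module.Basis.repr_self, Finsupp.single_apply,
        Pi.single_apply]
    rw [this]
    simp only [smul_eq_mul, map_mul, MvPolynomial.aeval_X, Pi.single_apply]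
    split_ifs <;> simp

/-- The partial derivatives of an algebraic relation are relations of lower degree, hence zero by
induction. In characteristic 0 the relation is then a constant, and so zero. The induction variable
is a strict bound for the degrees of the monomials. -/
lemma algebraicIndependent_of_derivation [Nontrivial A] (D : Fin N → Derivation K A A)
    (hD : ∀ i (p : MvPolynomial (Fin N) K), D i (MvPolynomial.aeval x p) = MvPolynomial.aeval x (MvPolynomial.pderiv i p)) :
    AlgebraicIndependent K x := by
  have key : ∀ (n : ℕ) (p : MvPolynomial (Fin N) K),
      (∀ m : Fin N →₀ ℕ, n ≤ m.degree → MvPolynomial.coeff m p = 0) →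
      MvPolynomial.aeval x p = 0 → p = 0 := by
    intro n
    induction n with
    | zero =>
      intro p hp _
      ext m
      exact hp m (Nat.zero_le _)
    | succ n ih =>
      intro p hp h0
      have hpd : ∀ i, MvPolynomial.pderiv i p = 0 := by
        intro i
        apply ih
        · intro m hm
          rw [MvPolynomial.coeff_pderiv, hp _ (by simpa using hm), zero_mul]
        · rw [← hD, h0, map_zero]
      have hc : ∀ m : Fin N →₀ ℕ, m ≠ 0 → MvPolynomial.coeff m p = 0 := by
        intro m hm
        obtain ⟨i, k, rfl⟩ := Finsupp.exists_eq_add_single hm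
        have := congrArg (MvPolynomial.coeff k) (hpd i)
        rw [MvPolynomial.coeff_pderiv, MvPolynomial.coeff_zero] at this
        refine (mul_eq_zero.1 this).resolve_right ?_
        exact_mod_cast Nat.succ_ne_zero (k i)
      have hpC : p = MvPolynomial.C (MvPolynomial.coeff 0 p) := by
        classical
        ext m
        rw [MvPolynomial.coeff_C]
        split_ifs with h
        · rw [← h]
        · exact hc m (Ne.symm h)
      rw [hpC, MvPolynomial.aeval_C, map_eq_zero] at h0
      rw [hpC, h0, map_zero]
  rw [algebraicIndependent_iff]
  intro p hp
  refine key (p.totalDegree + 1) p (fun m hm => ?_) hp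
  by_contra h
  have := MvPolynomial.le_totalDegree (MvPolynomial.mem_support_iff.2 h)
  rw [Finsupp.degree_eq_sum] at hm
  rw [Finsupp.sum_fintype _ _ (fun _ => rfl)] at this
  omega

omit [CharZero K] in
-- Let `S = K[x]` and `L = Frac A`. The `dxᵢ` generate the differentials of `A` and vanish over
-- `Frac S`, so `L` has no differentials over `Frac S`. Being essentially of finite type and
-- formally unramified, this field extension is separable, in particular algebraic.
lemma isAlgebraic_of_basis [IsDomain A] [Algebra.FiniteType K A]
    (b : Module.Basis (Fin N) A Ω[A⁄K])
    (hb : ∀ i, b i = KaehlerDifferential.D K A (x i)) (f : A) :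
    IsAlgebraic (Algebra.adjoin K (Set.range x)) f := by
  let S := Algebra.adjoin K (Set.range x)
  let L := FractionRing A
  let _ := FractionRing.liftAlgebra S L
  have := FractionRing.isScalarTower_liftAlgebra S L
  have : IsScalarTower K S L := IsScalarTower.to₁₂₄ K S A L
  have : IsScalarTower K (FractionRing S) L := inferInstance
  have hA : ∀ a : A, KaehlerDifferential.D (FractionRing S) L (algebraMap A L a) = 0 := by
    let D : Derivation K A Ω[L⁄FractionRing S] :=
      ((KaehlerDifferential.D (FractionRing S) L).restrictScalars K).compAlgebraMap A
    have hD : D.liftKaehlerDifferential = 0 := by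
      apply b.ext
      intro i
      rw [hb, Derivation.liftKaehlerDifferential_comp_D]
      change KaehlerDifferential.D (FractionRing S) L (algebraMap A L (x i)) = 0
      have : algebraMap A L (x i) = algebraMap (FractionRing S) L (algebraMap S (FractionRing S)
          ⟨x i, Algebra.subset_adjoin ⟨i, rfl⟩⟩) := by
        rw [← IsScalarTower.algebraMap_apply S (FractionRing S) L]
        rfl
      rw [this, Derivation.map_algebraMap]
    intro a
    have := D.liftKaehlerDifferential_comp_D a
    rw [hD] at this
    exact this.symm
  have : Algebra.FormallyUnramified (FractionRing S) L := by
    refine ⟨?_⟩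
    rw [← Submodule.subsingleton_iff L, ← subsingleton_iff_bot_eq_top,
      ← KaehlerDifferential.span_range_derivation, eq_comm, Submodule.span_eq_bot]
    rintro _ ⟨l, rfl⟩
    obtain ⟨a, s, -, rfl⟩ := IsFractionRing.div_surjective A l
    rw [Derivation.leibniz_div, hA, hA]
    simp
  have : Algebra.EssFiniteType K L := Algebra.EssFiniteType.comp K A L
  have : Algebra.EssFiniteType (FractionRing S) L := Algebra.EssFiniteType.of_comp K _ L
  have : Algebra.IsSeparable (FractionRing S) L := Algebra.FormallyUnramified.isSeparable _ L
  have h1 : IsAlgebraic (FractionRing S) (algebraMap A L f) :=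
    (Algebra.IsSeparable.isAlgebraic (FractionRing S) L).isAlgebraic _
  rw [← IsFractionRing.isAlgebraic_iff S] at h1
  exact (isAlgebraic_algebraMap_iff (FaithfulSMul.algebraMap_injective A L)).1 h1

/-- Functions whose differentials form a basis of the module of differentials are uniformizing
parameters. -/
lemma isUniformizing_of_basis [IsDomain A] [Algebra.FiniteType K A]
    (b : Module.Basis (Fin N) A Ω[A⁄K])
    (hb : ∀ i, b i = KaehlerDifferential.D K A (x i)) : IsUniformizing K x where
  algebraicIndependent := algebraicIndependent_of_derivation
    (fun i => (b.coord i).compDer (KaehlerDifferential.D K A)) (coord_aeval_of_basis b hb)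
  algebraic := isAlgebraic_of_basis b hb
  exists_derivation i := ⟨_, coord_aeval_of_basis b hb i⟩

/-- In a submersive presentation the differentials of the free variables, those not matched with a
relation, form a basis of the module of differentials. Its rank identifies their number with `N`. -/
lemma exists_isUniformizing_of_isStandardSmooth [IsDomain A]
    [h : Algebra.IsStandardSmoothOfRelativeDimension N K A] :
    ∃ x : Fin N → A, IsUniformizing K x := by
  obtain ⟨ι, σ, _, _, P, hP⟩ := h.out
  have : Algebra.IsStandardSmooth K A := h.isStandardSmooth
  let b := P.basisKaehler
  have hfin : Module.Finite A Ω[A⁄K] := inferInstance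
  have hcard : Module.finrank A Ω[A⁄K] = N := by
    rw [Module.finrank, P.rank_kaehlerDifferential, hP]
    simp
  have : Finite ((Set.range P.map)ᶜ : Set ι) := inferInstance
  let _ : Fintype ((Set.range P.map)ᶜ : Set ι) := Fintype.ofFinite _
  let e : ((Set.range P.map)ᶜ : Set ι) ≃ Fin N :=
    Fintype.equivFinOfCardEq (by rw [← hcard, Module.finrank_eq_card_basis b])
  exact ⟨_, isUniformizing_of_basis (b.reindex e) (x := fun i => P.val (e.symm i)) fun i => by
    rw [Module.Basis.reindex_apply, P.basisKaehler_apply]⟩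

end KaehlerBasis

open scoped KaehlerDifferential in
/-- The differentials of uniformizing parameters form a basis of the module of differentials when
the latter is projective. -/
lemma IsUniformizing.exists_basis_kaehler {K A : Type u} [Field K] [CharZero K] [CommRing A]
    [IsDomain A] [Algebra K A] {N : ℕ} {x : Fin N → A} (h : IsUniformizing K x)
    [Module.Projective A (Ω[A⁄K])] :
    ∃ b : Module.Basis (Fin N) A (Ω[A⁄K]), ∀ i, b i = KaehlerDifferential.D K A (x i) := by
  let φ : Ω[A⁄K] →ₗ[A] (Fin N → A) := LinearMap.pi fun i => (h.pderiv i).liftKaehlerDifferential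
  have hφ : ∀ i, φ (KaehlerDifferential.D K A (x i)) = Pi.single i 1 := by
    intro i
    ext j
    change (h.pderiv j).liftKaehlerDifferential (KaehlerDifferential.D K A (x i)) = _
    rw [Derivation.liftKaehlerDifferential_comp_D, h.pderiv_param]
    simp only [Pi.single_apply, eq_comm]
  have hinj : Function.Injective φ := by
    rw [injective_iff_map_eq_zero]
    intro ω hω
    -- Linear forms separate the elements of a projective module. Each form is a derivation of `A`,
    -- hence a combination of the `∂/∂xᵢ`, so `ω` is zero as soon as these vanish on it.
    rw [← Module.forall_dual_apply_eq_zero_iff A]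
    intro ℓ
    have h1 : ℓ = ∑ i, ℓ (KaehlerDifferential.D K A (x i)) •
        (h.pderiv i).liftKaehlerDifferential := by
      apply Derivation.liftKaehlerDifferential_unique
      ext f
      change ℓ (KaehlerDifferential.D K A f) = _
      have := h.derivation_apply (ℓ.compDer (KaehlerDifferential.D K A)) f
      change ℓ (KaehlerDifferential.D K A f) = _ at this
      simp [this]
    rw [h1, LinearMap.sum_apply]
    refine Finset.sum_eq_zero fun i _ => ?_
    have : (h.pderiv i).liftKaehlerDifferential ω = 0 := congrFun hω i
    rw [LinearMap.smul_apply, this, smul_zero]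
  have hsurj : Function.Surjective φ := by
    intro v
    refine ⟨∑ i, v i • KaehlerDifferential.D K A (x i), ?_⟩
    ext j
    simp [hφ, Pi.single_apply]
  let e := LinearEquiv.ofBijective φ ⟨hinj, hsurj⟩
  refine ⟨Module.Basis.ofEquivFun e, fun i => ?_⟩
  rw [Module.Basis.coe_ofEquivFun, LinearEquiv.symm_apply_eq]
  exact (hφ i).symm

/-- Derivations extend along formally étale homomorphisms. -/
lemma Derivation.exists_extension {K A F : Type*} [CommRing K] [CommRing A] [CommRing F]
    [Algebra K A] [Algebra K F] [Algebra A F] [IsScalarTower K A F] [Algebra.FormallyEtale A F]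
    (D : Derivation K A A) :
    ∃ D' : Derivation K F F, ∀ a, D' (algebraMap A F a) = algebraMap A F (D a) := by
  let D₁ : Derivation K A F := (Algebra.linearMap A F).compDer D
  -- For a formally étale map the differentials of `F` are the base change of those of `A`, so the
  -- linear form attached to `D` extends `F`-linearly.
  refine ⟨(((TensorProduct.AlgebraTensorModule.lift
    (LinearMap.toSpanSingleton F _ D₁.liftKaehlerDifferential)) ∘ₗ
    (KaehlerDifferential.tensorKaehlerEquivOfFormallyEtale K A F).symm.toLinearMap).compDer
      (KaehlerDifferential.D K F)), fun a => ?_⟩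
  simp [KaehlerDifferential.tensorKaehlerEquivOfFormallyEtale_symm_D_algebraMap, D₁]
end

/-! ### Restriction of functions, derivations and parameters to open subsets. -/

noncomputable section

section Functions

variable {X : Scheme.{u}}

@[simp] lemma resFun_self {V : X.Opens} (h : V ≤ V) (f : Γ(X, V)) : resFun h f = f := by
  have : homOfLE h = 𝟙 V := rfl
  rw [resFun, this, op_id, CategoryTheory.Functor.map_id]
  rfl

/-- The empty open set is treated apart throughout: its ring of functions is zero, so it is not a
domain and admits no uniformizing parameters. -/
lemma subsingleton_sections {V : X.Opens} (h : ¬Nonempty V) : Subsingleton Γ(X, V) := by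
  have hbot : V = ⊥ := by
    ext p
    simp only [TopologicalSpace.Opens.coe_bot, Set.mem_empty_iff_false, iff_false]
    exact fun hp => h ⟨p, hp⟩
  rw [hbot]
  infer_instance

/-- Gluing of regular functions. -/
lemma existsUnique_glue_resFun {ι : Type*} {V : X.Opens} (W : ι → X.Opens) (hW : ∀ i, W i ≤ V)
    (hV : V ≤ iSup W) (s : ∀ i, Γ(X, W i))
    (hs : ∀ i j, resFun (inf_le_left : W i ⊓ W j ≤ W i) (s i) =
      resFun (inf_le_right : W i ⊓ W j ≤ W j) (s j)) :
    ∃! f : Γ(X, V), ∀ i, resFun (hW i) f = s i :=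
  X.sheaf.existsUnique_gluing' W V (fun i => homOfLE (hW i)) hV s hs

lemma resFun_injective [IsIntegral X] {V W : X.Opens} (h : V ≤ W) [Nonempty V] :
    Function.Injective (resFun h) :=
  map_injective_of_isIntegral X (homOfLE h)

instance isDomain_sections [IsIntegral X] (V : X.Opens) [Nonempty V] : IsDomain Γ(X, V) :=
  inferInstance

lemma germToFunctionField_resFun [IsIntegral X] {V W : X.Opens} (h : V ≤ W) [Nonempty V]
    [Nonempty W] (f : Γ(X, W)) :
    X.germToFunctionField V (resFun h f) = X.germToFunctionField W f := by
  simp only [Scheme.germToFunctionField, resFun]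
  exact TopCat.Presheaf.germ_res_apply _ _ _ _ _

/-- Nonempty open subsets of an integral scheme meet. -/
lemma nonempty_inf [IsIntegral X] (V W : X.Opens) [hV : Nonempty V] [hW : Nonempty W] :
    Nonempty (V ⊓ W : X.Opens) := by
  obtain ⟨v⟩ := hV
  obtain ⟨w⟩ := hW
  obtain ⟨p, hp⟩ := nonempty_preirreducible_inter V.isOpen W.isOpen ⟨v.1, v.2⟩ ⟨w.1, w.2⟩
  exact ⟨⟨p, hp⟩⟩

/-- Locally, regular functions are fractions of functions on a given affine open subset. -/
lemma exists_fraction {U : X.Opens} (hU : IsAffineOpen U) {V : X.Opens} (h : V ≤ U)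
    (f : Γ(X, V)) (p : V) :
    ∃ (W : X.Opens) (hW : W ≤ V), p.1 ∈ W ∧ ∃ a s : Γ(X, U), IsUnit (resFun (hW.trans h) s) ∧
      resFun hW f * resFun (hW.trans h) s = resFun (hW.trans h) a := by
  obtain ⟨g, hgV, hpg⟩ := hU.exists_basicOpen_le ⟨p.1, p.2⟩ (h p.2)
  have := hU.isLocalization_basicOpen g
  obtain ⟨⟨a, s⟩, has⟩ := IsLocalization.surj (Submonoid.powers g) (resFun hgV f)
  exact ⟨_, hgV, hpg, a, s, IsLocalization.map_units Γ(X, X.basicOpen g) s, has⟩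

variable (K : Type u) [Field K] [X.Over (Spec (.of K))]

lemma resFun_algebraMap {V W : X.Opens} (h : V ≤ W) (r : K) :
    resFun h (algebraMap K Γ(X, W) r) = algebraMap K Γ(X, V) r := by
  have := (constToStructureSheaf K X).naturality (homOfLE h).op
  exact (ConcreteCategory.congr_hom this r).symm

/-- Restriction of regular functions, as a homomorphism of `K`-algebras. -/
def resAlg {V W : X.Opens} (h : V ≤ W) : Γ(X, W) →ₐ[K] Γ(X, V) where
  __ := resFun h
  commutes' := resFun_algebraMap K h

@[simp] lemma resAlg_apply {V W : X.Opens} (h : V ≤ W) (f : Γ(X, W)) :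
    resAlg K h f = resFun h f := rfl

variable {K} [CharZero K] [IsIntegral X]

omit [CharZero K] in
/-- Derivations of the ring of functions on an affine open subset of an integral scheme extend to
its nonempty open subsets. -/
lemma exists_derivation_resFun {U : X.Opens} (hU : IsAffineOpen U) {V : X.Opens} (h : V ≤ U)
    [Nonempty V] (D : Derivation K Γ(X, U) Γ(X, U)) :
    ∃ D' : Derivation K Γ(X, V) Γ(X, V), ∀ f, D' (resFun h f) = resFun h (D f) := by
  have : Nonempty U := ⟨⟨_, h (Classical.arbitrary V).2⟩⟩
  have hfrac := functionField_isFractionRing_of_isAffineOpen X U hU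
  let _ : Algebra K X.functionField :=
    ((algebraMap Γ(X, U) X.functionField).comp (algebraMap K Γ(X, U))).toAlgebra
  have : IsScalarTower K Γ(X, U) X.functionField := IsScalarTower.of_algebraMap_eq fun _ => rfl
  -- The function field is a localization, hence formally étale, so `D` extends to a derivation `E`
  -- of it. It remains to see that `E` preserves the functions on `V`.
  have : Algebra.FormallyEtale Γ(X, U) X.functionField :=
    Algebra.FormallyEtale.of_isLocalization (nonZeroDivisors Γ(X, U))
  obtain ⟨E, hE⟩ := D.exists_extension (F := X.functionField)
  have hE' : ∀ f : Γ(X, U), E (X.germToFunctionField U f) = X.germToFunctionField U (D f) := hE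
  have hK : ∀ (W : X.Opens) [Nonempty W] (r : K),
      X.germToFunctionField W (algebraMap K Γ(X, W) r) = algebraMap K X.functionField r := by
    intro W _ r
    have := nonempty_inf U W
    rw [← germToFunctionField_resFun (inf_le_right : U ⊓ W ≤ W), resFun_algebraMap,
      ← resFun_algebraMap K (inf_le_left : U ⊓ W ≤ U), germToFunctionField_resFun]
    rfl
  have hloc : ∀ f : Γ(X, V), ∃ f' : Γ(X, V),
      X.germToFunctionField V f' = E (X.germToFunctionField V f) := by
    intro f
    choose W hWV hpW a b hb hab using exists_fraction hU h f
    have hne : ∀ p, Nonempty (W p) := fun p => ⟨⟨p.1, hpW p⟩⟩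
    have hs : ∀ p, ∃ s : Γ(X, W p),
        X.germToFunctionField _ s = E (X.germToFunctionField V f) := by
      intro p
      -- Where `f = a / b` with `a`, `b` defined on `U`, the quotient rule gives `E f = (D a - f · D
      -- b) / b`, which is regular there. These local functions agree in the function field and
      -- therefore glue.
      obtain ⟨u, hu⟩ := hb p
      refine ⟨↑u⁻¹ * (resFun ((hWV p).trans h) (D (a p)) -
        resFun (hWV p) f * resFun ((hWV p).trans h) (D (b p))), ?_⟩
      have h1 := congrArg (X.germToFunctionField (W p)) (hab p)
      simp only [map_mul, germToFunctionField_resFun] at h1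
      have h2 := congrArg E h1
      rw [E.leibniz, hE', hE', smul_eq_mul, smul_eq_mul] at h2
      have h3 : X.germToFunctionField (W p) (↑u⁻¹ : Γ(X, W p)) *
          X.germToFunctionField U (b p) = 1 := by
        rw [← germToFunctionField_resFun ((hWV p).trans h), ← hu, ← map_mul, Units.inv_mul,
          map_one]
      simp only [map_mul, map_sub, germToFunctionField_resFun]
      rw [← h2]
      linear_combination (E (X.germToFunctionField V f)) * h3
    choose s hs using hs
    have hcompat : ∀ p q, resFun (inf_le_left : W p ⊓ W q ≤ _) (s p) =
        resFun inf_le_right (s q) := by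
      intro p q
      have := nonempty_inf (W p) (W q)
      apply X.germToFunctionField_injective
      rw [germToFunctionField_resFun, germToFunctionField_resFun, hs, hs]
    obtain ⟨f', hf', -⟩ := existsUnique_glue_resFun (V := V) W hWV
      (fun p hp => TopologicalSpace.Opens.mem_iSup.2 ⟨⟨p, hp⟩, hpW ⟨p, hp⟩⟩) s hcompat
    refine ⟨f', ?_⟩
    let p : V := Classical.arbitrary V
    rw [← germToFunctionField_resFun (hWV p), hf', hs]
  choose D' hD' using hloc
  have hinj := X.germToFunctionField_injective V
  have hmul := map_mul (X.germToFunctionField V).hom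
  refine ⟨Derivation.mk' 
    { toFun := D'
      map_add' := fun f g => hinj (by simp only [hD', map_add])
      map_smul' := fun r f => hinj (by
        rw [RingHom.id_apply, hD', Algebra.smul_def, Algebra.smul_def, hmul, hmul, hK, hD',
          E.leibniz, E.map_algebraMap, smul_zero, add_zero, smul_eq_mul]) }
    (fun f g => hinj (by
      change X.germToFunctionField V (D' (f * g)) =
        X.germToFunctionField V (f * D' g + g * D' f)
      simp only [map_add, map_mul, hD', E.leibniz, smul_eq_mul])), fun f => hinj ?_⟩
  change X.germToFunctionField V (D' (resFun h f)) = _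
  rw [hD', germToFunctionField_resFun, germToFunctionField_resFun, hE']

omit [CharZero K] in
/-- Uniformizing parameters on an affine open subset restrict to uniformizing parameters on its
nonempty open subsets. -/
lemma IsUniformizing.restrict {N : ℕ} {U : X.Opens} (hU : IsAffineOpen U) {V : X.Opens}
    (h : V ≤ U) [Nonempty V] {x : Fin N → Γ(X, U)} (hx : IsUniformizing K x) :
    IsUniformizing K fun i => resFun h (x i) where
  algebraicIndependent := hx.algebraicIndependent.map' (f := resAlg K h) (resFun_injective h)
  algebraic f := by
    -- `V` need not be affine. A fraction for `f` near one point suffices: `s f = a` then holds on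
    -- all of `V` by injectivity of restriction, and `f` is algebraic because `s` and `a` are.
    obtain ⟨W, hW, hpW, a, s, hs, has⟩ := exists_fraction hU h f (Classical.arbitrary V)
    have : Nonempty W := ⟨⟨_, hpW⟩⟩
    have : Nonempty U := ⟨⟨_, h (Classical.arbitrary V).2⟩⟩
    have halg : ∀ g : Γ(X, U),
        IsAlgebraic (Algebra.adjoin K (Set.range fun i => resFun h (x i))) (resFun h g) := by
      intro g
      have hS : ∀ t : Algebra.adjoin K (Set.range x),
          resAlg K h t ∈ Algebra.adjoin K (Set.range fun i => resFun h (x i)) := by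
        intro t
        have : (Algebra.adjoin K (Set.range x)).map (resAlg K h) =
            Algebra.adjoin K (Set.range fun i => resFun h (x i)) := by
          rw [AlgHom.map_adjoin, ← Set.range_comp]
          rfl
        rw [← this]
        exact ⟨t, t.2, rfl⟩
      let φ : Algebra.adjoin K (Set.range x) →ₐ[K]
          Algebra.adjoin K (Set.range fun i => resFun h (x i)) :=
        ((resAlg K h).comp (Subalgebra.val _)).codRestrict _ hS
      have hφ : Function.Injective φ := fun s t hst =>
        Subtype.ext (resFun_injective h (congrArg Subtype.val hst))
      refine (hx.algebraic g).ringHom_of_comp_eq φ (resFun h) hφ ?_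
      rfl
    have hs0 : resFun h s ≠ 0 := by
      intro h0
      rw [← resFun_resFun hW h, h0, map_zero] at hs
      exact not_isUnit_zero hs
    have heq : resFun h s * f = resFun h a := by
      apply resFun_injective hW
      rw [map_mul, resFun_resFun, resFun_resFun, mul_comm, has]
    refine IsAlgebraic.of_mul (mem_nonZeroDivisors_of_ne_zero hs0) (halg s) ?_
    rw [heq]
    exact halg a
  exists_derivation i := by
    obtain ⟨D, hD⟩ := exists_derivation_resFun hU h (hx.pderiv i)
    refine ⟨D, fun p => ?_⟩
    have haeval : ∀ p : MvPolynomial (Fin N) K,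
        MvPolynomial.aeval (fun i => resFun h (x i)) p = resFun h (MvPolynomial.aeval x p) :=
      fun p => (MvPolynomial.comp_aeval_apply x (resAlg K h) p).symm
    rw [haeval, hD, hx.pderiv_aeval, haeval]

end Functions
end

/-! ### Étale charts of a smooth integral scheme. -/

noncomputable section

section Charts

variable {K : Type u} [Field K] {X : Scheme.{u}} [X.Over (Spec (.of K))] {N : ℕ}

/-- The étale charts of a smooth integral scheme cover it. -/
lemma exists_etaleChart [CharZero K] [IsIntegral X]
    [SmoothOfRelativeDimension N (X ↘ Spec (.of K))] (P : X) :
    ∃ c : EtaleChart K X N, P ∈ c.U := by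
  obtain ⟨U, hU, V, hV, hPV, e, hsm⟩ :=
    SmoothOfRelativeDimension.exists_isStandardSmoothOfRelativeDimension
      (n := N) (f := X ↘ Spec (.of K)) P
  -- The spectrum of a field is a single point, so the open subset of the base is everything.
  have hUtop : U = ⊤ := by
    have : Subsingleton (Spec (.of K)) := inferInstanceAs (Subsingleton (PrimeSpectrum K))
    ext p
    simp only [TopologicalSpace.Opens.coe_top, Set.mem_univ, iff_true]
    rw [Subsingleton.elim p ((X ↘ Spec (.of K)) P)]
    exact e hPV
  subst hUtop
  have : Nonempty V := ⟨⟨P, hPV⟩⟩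
  have hmap : sectionsStructureMap K X V = (Scheme.ΓSpecIso (.of K)).inv ≫
      (X ↘ Spec (.of K)).appLE ⊤ V e := rfl
  have h : (sectionsStructureMap K X V).hom.IsStandardSmoothOfRelativeDimension N := by
    rw [hmap]
    exact RingHom.isStandardSmoothOfRelativeDimension_respectsIso.right _
      (Scheme.ΓSpecIso (.of K)).symm.commRingCatIsoToRingEquiv hsm
  have : Algebra.IsStandardSmoothOfRelativeDimension N K Γ(X, V) := h
  obtain ⟨x, hx⟩ := exists_isUniformizing_of_isStandardSmooth (K := K) (A := Γ(X, V)) (N := N)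
  exact ⟨⟨V, hV, x, hx⟩, hPV⟩

/-- Smoothness passes to every affine open subset, not only to those with a standard smooth
presentation. This is what makes the `dxᵢ` a basis of differentials on affine open subsets of an
arbitrary chart. -/
lemma projective_kaehler [SmoothOfRelativeDimension N (X ↘ Spec (.of K))] {V : X.Opens}
    (hV : IsAffineOpen V) : Module.Projective Γ(X, V) (KaehlerDifferential K Γ(X, V)) := by
  have : Smooth (X ↘ Spec (.of K)) := SmoothOfRelativeDimension.smooth N _
  have hsm := Scheme.Hom.smooth_appLE (X ↘ Spec (.of K)) (isAffineOpen_top _) hV le_top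
  have hmap : sectionsStructureMap K X V = (Scheme.ΓSpecIso (.of K)).inv ≫
      (X ↘ Spec (.of K)).appLE ⊤ V le_top := rfl
  have h : (sectionsStructureMap K X V).hom.Smooth := by
    rw [hmap]
    exact RingHom.Smooth.respectsIso.right _
      (Scheme.ΓSpecIso (.of K)).symm.commRingCatIsoToRingEquiv hsm
  have : Algebra.Smooth K Γ(X, V) := h
  infer_instance

namespace EtaleChart

/-- Over the zero ring even the polynomials `1` and `0` take the same value, against algebraic
independence. -/
lemma nonempty (c : EtaleChart K X N) : Nonempty c.U := by
  by_contra h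
  have := subsingleton_sections h
  exact one_ne_zero (c.isUniformizing.algebraicIndependent (Subsingleton.elim
    (MvPolynomial.aeval c.x (1 : MvPolynomial (Fin N) K)) (MvPolynomial.aeval c.x 0)))

/-- The uniformizing parameters of a chart on an open subset. -/
def param (c : EtaleChart K X N) {V : X.Opens} (h : V ≤ c.U) (i : Fin N) : Γ(X, V) :=
  resFun h (c.x i)

lemma resFun_param (c : EtaleChart K X N) {V W : X.Opens} (hVW : V ≤ W) (h : W ≤ c.U)
    (i : Fin N) : resFun hVW (c.param h i) = c.param (hVW.trans h) i :=
  resFun_resFun hVW h _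

variable [CharZero K] [IsIntegral X] (c c₁ c₂ c₃ : EtaleChart K X N)

omit [CharZero K] in
lemma uniformizing {V : X.Opens} [Nonempty V] (h : V ≤ c.U) : IsUniformizing K (c.param h) :=
  IsUniformizing.restrict c.isAffineOpen h c.isUniformizing

lemma resFun_pderiv {V W : X.Opens} [Nonempty V] [Nonempty W] (hVW : V ≤ W) (h : W ≤ c.U)
    (i : Fin N) (f : Γ(X, W)) :
    resFun hVW ((c.uniformizing h).pderiv i f) =
      (c.uniformizing (hVW.trans h)).pderiv i (resFun hVW f) :=
  IsUniformizing.map_pderiv (resAlg K hVW) (resFun_injective hVW) (c.resFun_param hVW h) _ _ i f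

/-- The vector field `∂/∂xⱼ` on an étale chart. -/
def vectorField (j : Fin N) : vectorFields K X c.U :=
  open scoped Classical in
  -- The value over the empty set is a default; the zero ring has only one derivation.
  ⟨fun V => if hV : Nonempty V.1 then (c.uniformizing V.2).pderiv j else 0, by
    intro V V' h f
    by_cases hV' : Nonempty V'.1
    · have hV : Nonempty V.1 := ⟨⟨_, h (Classical.arbitrary V'.1).2⟩⟩
      simp only [dif_pos hV, dif_pos hV']
      exact (c.resFun_pderiv h V.2 j f).symm
    · have := subsingleton_sections hV'
      exact Subsingleton.elim _ _⟩

lemma vectorField_apply (j : Fin N) (V : {V : X.Opens // V ≤ c.U}) [hV : Nonempty V.1] :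
    (c.vectorField j).1 V = (c.uniformizing V.2).pderiv j :=
  dif_pos hV

lemma vectorField_self (j : Fin N) :
    (c.vectorField j).1 ⟨c.U, le_rfl⟩ = c.isUniformizing.pderiv j := by
  have := c.nonempty
  rw [vectorField_apply]
  apply c.isUniformizing.derivation_ext
  intro i
  have h : c.param le_rfl i = c.x i := resFun_self _ _
  rw [IsUniformizing.pderiv_param, ← h, IsUniformizing.pderiv_param]

/-- The transition map between formal vector fields over an open subset of two charts. -/
def transition {V : X.Opens} [Nonempty V] (h₁ : V ≤ c₁.U) (h₂ : V ≤ c₂.U) :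
    FormalVF N Γ(X, V) →ₗ[Γ(X, V)] FormalVF N Γ(X, V) :=
  (c₁.uniformizing h₁).transition (c₂.uniformizing h₂)

lemma map_transition {V W : X.Opens} [Nonempty V] [Nonempty W] (hVW : V ≤ W) (h₁ : W ≤ c₁.U)
    (h₂ : W ≤ c₂.U) (v : FormalVF N Γ(X, W)) (q : Fin N) :
    MvPowerSeries.map (resFun hVW) (c₁.transition c₂ h₁ h₂ v q) =
      c₁.transition c₂ (hVW.trans h₁) (hVW.trans h₂)
        (fun j => MvPowerSeries.map (resFun hVW) (v j)) q :=
  IsUniformizing.map_transition (resAlg K hVW) (resFun_injective hVW) (c₁.resFun_param hVW h₁)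
    (c₂.resFun_param hVW h₂) _ _ _ _ v q

end EtaleChart

end Charts
end

/-! ### Gluing sheaves of modules from transition maps. -/

noncomputable section

/-- A morphism of sheaves of modules, given by compatible linear maps between sections. -/
def AlgebraicGeometry.Scheme.Modules.homMk {X : Scheme.{u}} {M N : X.Modules}
    (f : ∀ W : X.Opens, Γ(M, W) →ₗ[Γ(X, W)] Γ(N, W))
    (hf : ∀ (V W : X.Opens) (h : V ≤ W) (s : Γ(M, W)),
      f V (M.presheaf.map (homOfLE h).op s) = N.presheaf.map (homOfLE h).op (f W s)) : M ⟶ N :=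
  SheafOfModules.Hom.mk (PresheafOfModules.homMk
    { app := fun W => AddCommGrpCat.ofHom (f W.unop).toAddMonoidHom
      naturality := fun V W i => by
        ext s
        exact hf W.unop V.unop i.unop.le s }
    fun W r m => (f W.unop).map_smul r m)

section Glue

variable (K : Type u) [Field K] (X : Scheme.{u}) [X.Over (Spec (.of K))] (N : ℕ)

/-- Transition maps between trivial bundles with fibre `K^ι` over the étale charts. -/
structure ChartCocycle (ι : Type) where
  /-- The transition maps. -/
  T : ∀ (c₁ c₂ : EtaleChart K X N) (V : X.Opens) [Nonempty V], V ≤ c₁.U → V ≤ c₂.U →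
    ((ι → Γ(X, V)) →ₗ[Γ(X, V)] (ι → Γ(X, V)))
  resFun_T : ∀ (c₁ c₂ : EtaleChart K X N) (V W : X.Opens) [Nonempty V] [Nonempty W] (h : V ≤ W)
    (h₁ : W ≤ c₁.U) (h₂ : W ≤ c₂.U) (v : ι → Γ(X, W)) (i : ι),
    resFun h (T c₁ c₂ W h₁ h₂ v i) =
      T c₁ c₂ V (h.trans h₁) (h.trans h₂) (fun j => resFun h (v j)) i
  T_self : ∀ (c : EtaleChart K X N) (V : X.Opens) [Nonempty V] (h : V ≤ c.U) (v : ι → Γ(X, V)),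
    T c c V h h v = v
  T_trans : ∀ (c₁ c₂ c₃ : EtaleChart K X N) (V : X.Opens) [Nonempty V] (h₁ : V ≤ c₁.U)
    (h₂ : V ≤ c₂.U) (h₃ : V ≤ c₃.U) (v : ι → Γ(X, V)),
    T c₂ c₃ V h₂ h₃ (T c₁ c₂ V h₁ h₂ v) = T c₁ c₃ V h₁ h₃ v

/-- The nonempty open subsets of `W` with a chart. -/
structure ChartOpen (W : X.Opens) where
  /-- The chart. -/
  c : EtaleChart K X N
  /-- The open subset. -/
  V : X.Opens
  ne : Nonempty V
  le : V ≤ W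
  le_chart : V ≤ c.U

attribute [instance] ChartOpen.ne

variable {K X N}

/-- Open subsets of `V` with a chart are open subsets of `W ⊇ V` with a chart. -/
def ChartOpen.mono {V W : X.Opens} (h : V ≤ W) (p : ChartOpen K X N V) : ChartOpen K X N W :=
  ⟨p.c, p.V, p.ne, p.le.trans h, p.le_chart⟩

namespace ChartCocycle

variable {ι κ : Type} (P : ChartCocycle K X N ι) (Q : ChartCocycle K X N κ)

/-- The sections over `W` of the bundle with the given transition maps: compatible families of
sections of the trivial bundles. -/
def sections (W : X.Opens) : AddSubgroup (∀ p : ChartOpen K X N W, ι → Γ(X, p.V)) where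
  carrier := {s | ∀ (p q : ChartOpen K X N W) (h : q.V ≤ p.V),
    P.T p.c q.c q.V (h.trans p.le_chart) q.le_chart (fun i => resFun h (s p i)) = s q}
  add_mem' {s t} hs ht p q h := by
    simp only [Pi.add_apply, map_add]
    rw [← hs p q h, ← ht p q h, ← map_add]
    rfl
  zero_mem' p q h := by
    simp only [Pi.zero_apply, map_zero]
    exact map_zero _
  neg_mem' {s} hs p q h := by
    simp only [Pi.neg_apply, map_neg]
    rw [← hs p q h, ← map_neg]
    rfl

instance sectionsModule (W : X.Opens) : Module Γ(X, W) (P.sections W) where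
  smul a s := ⟨fun p i => resFun p.le a * s.1 p i, fun p q h => by
    change P.T p.c q.c q.V _ _ (fun i => resFun h (resFun p.le a * s.1 p i)) =
      resFun q.le a • s.1 q
    rw [← s.2 p q h, ← map_smul]
    congr 1
    ext1 i
    rw [map_mul, resFun_resFun]
    rfl⟩
  one_smul s := Subtype.ext <| funext fun p => funext fun i => by
    change resFun p.le 1 * s.1 p i = s.1 p i
    simp
  mul_smul a b s := Subtype.ext <| funext fun p => funext fun i => by
    change resFun p.le (a * b) * s.1 p i = resFun p.le a * (resFun p.le b * s.1 p i)
    simp [mul_assoc]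
  smul_zero a := Subtype.ext <| funext fun p => funext fun i => by
    change resFun p.le a * 0 = 0
    simp
  smul_add a s t := Subtype.ext <| funext fun p => funext fun i => by
    change resFun p.le a * (s.1 p i + t.1 p i) = resFun p.le a * s.1 p i + resFun p.le a * t.1 p i
    ring
  add_smul a b s := Subtype.ext <| funext fun p => funext fun i => by
    change resFun p.le (a + b) * s.1 p i = resFun p.le a * s.1 p i + resFun p.le b * s.1 p i
    rw [map_add, add_mul]
  zero_smul s := Subtype.ext <| funext fun p => funext fun i => by
    change resFun p.le 0 * s.1 p i = 0
    simp

/-- The compatibility condition changes the chart and the open set simultaneously. With the chart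
fixed, the transition map is the identity and only restriction remains. -/
lemma resFun_apply {W : X.Opens} (s : P.sections W) (c : EtaleChart K X N) {V V' : X.Opens}
    [hV : Nonempty V] [hV' : Nonempty V'] (hVV' : V' ≤ V) (hW : V ≤ W) (hc : V ≤ c.U) (i : ι) :
    resFun hVV' (s.1 ⟨c, V, hV, hW, hc⟩ i) =
      s.1 ⟨c, V', hV', hVV'.trans hW, hVV'.trans hc⟩ i := by
  have := s.2 ⟨c, V, hV, hW, hc⟩ ⟨c, V', hV', hVV'.trans hW, hVV'.trans hc⟩ hVV'
  rw [P.T_self] at this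
  exact congrFun this i

/-- Restriction of sections. -/
def restrict {V W : X.Opens} (h : V ≤ W) : P.sections W →+ P.sections V where
  toFun s := ⟨fun p => s.1 (p.mono h), fun p q hpq => s.2 (p.mono h) (q.mono h) hpq⟩
  map_zero' := rfl
  map_add' _ _ := rfl

@[simp] lemma restrict_apply {V W : X.Opens} (h : V ≤ W) (s : P.sections W)
    (p : ChartOpen K X N V) : (P.restrict h s).1 p = s.1 (p.mono h) := rfl

lemma restrict_smul {V W : X.Opens} (h : V ≤ W) (a : Γ(X, W)) (s : P.sections W) :
    P.restrict h (a • s) = resFun h a • P.restrict h s :=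
  Subtype.ext <| funext fun p => funext fun i => by
    change resFun (p.le.trans h) a * _ = resFun p.le (resFun h a) * _
    rw [resFun_resFun]
    rfl

/-- The presheaf of abelian groups of sections. -/
def presheafAb : X.Opensᵒᵖ ⥤ AddCommGrpCat.{u} where
  obj W := AddCommGrpCat.of (P.sections W.unop)
  map i := AddCommGrpCat.ofHom (P.restrict i.unop.le)
  map_id _ := rfl
  map_comp _ _ := rfl

instance presheafAbModule (W : X.Opensᵒᵖ) :
    Module ((X.presheaf ⋙ forget₂ CommRingCat RingCat).obj W) (P.presheafAb.obj W) :=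
  P.sectionsModule W.unop

variable [IsIntegral X]

/-- In a fixed chart, gluing happens one coefficient at a time, so an infinite index set does no
harm. Compatibility between charts and uniqueness are checked on a single nonempty intersection with
some `U j`, which is enough since restriction is injective on an integral scheme. -/
lemma existsUnique_glue {J : Type*} (U : J → X.Opens) (sf : ∀ j, P.sections (U j))
    (hsf : ∀ i j, P.restrict (inf_le_left : U i ⊓ U j ≤ U i) (sf i) =
      P.restrict (inf_le_right : U i ⊓ U j ≤ U j) (sf j)) :
    ∃! s : P.sections (iSup U), ∀ j, P.restrict (le_iSup U j) s = sf j := by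
  have hex : ∀ p : ChartOpen K X N (iSup U), ∃ j, Nonempty (U j ⊓ p.V : X.Opens) := by
    intro p
    have q := Classical.arbitrary p.V
    obtain ⟨j, hj⟩ := TopologicalSpace.Opens.mem_iSup.1 (p.le q.2)
    exact ⟨j, ⟨⟨q.1, hj, q.2⟩⟩⟩
  have hloc : ∀ p : ChartOpen K X N (iSup U), ∃ f : ι → Γ(X, p.V),
      ∀ (j : J) (h : Nonempty (U j ⊓ p.V : X.Opens)) (i : ι),
        resFun inf_le_right (f i) =
          (sf j).1 ⟨p.c, U j ⊓ p.V, h, inf_le_left, inf_le_right.trans p.le_chart⟩ i := by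
    intro p
    have : ∀ i : ι, ∃ f : Γ(X, p.V), ∀ j : {j : J // Nonempty (U j ⊓ p.V : X.Opens)},
        resFun inf_le_right f =
          (sf j.1).1 ⟨p.c, U j.1 ⊓ p.V, j.2, inf_le_left, inf_le_right.trans p.le_chart⟩ i := by
      intro i
      refine (existsUnique_glue_resFun (fun j : {j : J // Nonempty (U j ⊓ p.V : X.Opens)} =>
        U j.1 ⊓ p.V) (fun _ => inf_le_right) ?_ _ ?_).exists
      · intro q hq
        obtain ⟨j, hj⟩ := TopologicalSpace.Opens.mem_iSup.1 (p.le hq)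
        exact TopologicalSpace.Opens.mem_iSup.2 ⟨⟨j, ⟨⟨q, hj, hq⟩⟩⟩, hj, hq⟩
      · rintro ⟨j, hj⟩ ⟨k, hk⟩
        have := nonempty_inf (U j ⊓ p.V) (U k ⊓ p.V)
        rw [P.resFun_apply, P.resFun_apply]
        have := congrArg (fun s : P.sections (U j ⊓ U k) => s.1 ⟨p.c, (U j ⊓ p.V) ⊓ (U k ⊓ p.V),
          this, inf_le_inf inf_le_left inf_le_left,
          inf_le_left.trans (inf_le_right.trans p.le_chart)⟩ i) (hsf j k)
        exact this
    choose f hf using this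
    exact ⟨f, fun j h i => hf i ⟨j, h⟩⟩
  choose f hf using hloc
  refine ⟨⟨f, fun p q h => ?_⟩, fun j => Subtype.ext (funext fun p => funext fun i => ?_),
    fun t ht => Subtype.ext (funext fun p => funext fun i => ?_)⟩
  · obtain ⟨j, hj⟩ := hex q
    have hjp : Nonempty (U j ⊓ p.V : X.Opens) :=
      hj.map fun x => ⟨x.1, x.2.1, h x.2.2⟩
    ext1 i
    apply resFun_injective (inf_le_right : U j ⊓ q.V ≤ q.V)
    rw [P.resFun_T, hf q j hj]
    rw [← (sf j).2 ⟨p.c, U j ⊓ p.V, hjp, inf_le_left, inf_le_right.trans p.le_chart⟩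
      ⟨q.c, U j ⊓ q.V, hj, inf_le_left, inf_le_right.trans q.le_chart⟩ (inf_le_inf le_rfl h)]
    refine congrFun (congrArg (P.T _ _ _ _ _) (funext fun k => ?_)) i
    rw [← hf p j hjp, resFun_resFun, resFun_resFun]
  · have hj : Nonempty (U j ⊓ p.V : X.Opens) :=
      p.ne.map fun x => ⟨x.1, p.le x.2, x.2⟩
    apply resFun_injective (inf_le_right : U j ⊓ p.V ≤ p.V)
    refine (hf (p.mono (le_iSup U j)) j hj i).trans ?_
    exact (P.resFun_apply (sf j) p.c inf_le_right p.le p.le_chart i).symm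
  · obtain ⟨j, hj⟩ := hex p
    apply resFun_injective (inf_le_right : U j ⊓ p.V ≤ p.V)
    rw [hf p j hj, ← ht j]
    exact P.resFun_apply t p.c inf_le_right p.le p.le_chart i

/-- The presheaf of modules of sections. -/
def presheaf : PresheafOfModules.{u} (X.presheaf ⋙ forget₂ CommRingCat RingCat) :=
  PresheafOfModules.ofPresheaf P.presheafAb fun _ _ i r s => P.restrict_smul i.unop.le r s

/-- The sheaf of modules with the given transition maps. -/
def sheaf : X.Modules :=
  SheafOfModules.mk (R := X.ringCatSheaf) P.presheaf
    (by
      change TopCat.Presheaf.IsSheaf P.presheafAb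
      rw [TopCat.Presheaf.isSheaf_iff_isSheafUniqueGluing]
      intro J U sf hsf
      exact P.existsUnique_glue U sf hsf)

open scoped Classical in
/-- The trivialization over a chart. -/
def triv (c : EtaleChart K X N) (W : X.Opens) (hW : W ≤ c.U) :
    Γ(P.sheaf, W) ≃ₗ[Γ(X, W)] (ι → Γ(X, W)) where
  toFun s i := if h : Nonempty W then (s : P.sections W).1 ⟨c, W, h, le_rfl, hW⟩ i else 0
  map_add' s t := by
    ext1 i
    by_cases h : Nonempty W
    · simp only [Pi.add_apply, dif_pos h]
      rfl
    · simp [h]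
  map_smul' a s := by
    ext1 i
    by_cases h : Nonempty W
    · simp only [Pi.smul_apply, dif_pos h, RingHom.id_apply]
      change resFun _ a * _ = _
      rw [resFun_self]
      rfl
    · simp [h]
  -- One component over all of `W` determines the family: the others are its images under the
  -- transition maps, and the cocycle identity makes them compatible.
  invFun v := (⟨fun p => P.T c p.c p.V (p.le.trans hW) p.le_chart fun i => resFun p.le (v i),
    fun p q h => by
      simp only [P.resFun_T, resFun_resFun]
      exact P.T_trans _ _ _ _ _ _ _ _⟩ : P.sections W)
  left_inv s := Subtype.ext <| funext fun p => by
    have hne : Nonempty W := p.ne.map fun x => ⟨x.1, p.le x.2⟩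
    simp only [dif_pos hne]
    exact (s : P.sections W).2 ⟨c, W, hne, le_rfl, hW⟩ p p.le
  right_inv v := by
    ext1 i
    by_cases hne : Nonempty W
    · simp only [dif_pos hne, P.T_self, resFun_self]
    · have := subsingleton_sections hne
      exact Subsingleton.elim _ _

lemma triv_apply (c : EtaleChart K X N) (W : X.Opens) (hW : W ≤ c.U) [h : Nonempty W]
    (s : Γ(P.sheaf, W)) :
    P.triv c W hW s = (s : P.sections W).1 ⟨c, W, h, le_rfl, hW⟩ := by
  ext1 i
  exact dif_pos h

lemma triv_map (c : EtaleChart K X N) {V W : X.Opens} (hV : V ≤ W) (hW : W ≤ c.U)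
    (s : Γ(P.sheaf, W)) (i : ι) :
    P.triv c V (hV.trans hW) (P.sheaf.presheaf.map (homOfLE hV).op s) i =
      resFun hV (P.triv c W hW s i) := by
  by_cases h : Nonempty V
  · have : Nonempty W := h.map fun x => ⟨x.1, hV x.2⟩
    rw [triv_apply, triv_apply]
    exact (P.resFun_apply (s : P.sections W) c hV le_rfl hW i).symm
  · have := subsingleton_sections h
    exact Subsingleton.elim _ _

lemma triv_triv_symm (c₁ c₂ : EtaleChart K X N) (W : X.Opens) (h₁ : W ≤ c₁.U) (h₂ : W ≤ c₂.U)
    [Nonempty W] (v : ι → Γ(X, W)) :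
    P.triv c₂ W h₂ ((P.triv c₁ W h₁).symm v) = P.T c₁ c₂ W h₁ h₂ v := by
  rw [triv_apply]
  change P.T _ _ _ _ _ (fun i => resFun le_rfl (v i)) = _
  simp only [resFun_self]

variable {P Q}

/-- The morphism of sheaves given by compatible linear maps between the trivial bundles. -/
def hom (φ : ∀ (V : X.Opens) [Nonempty V], (ι → Γ(X, V)) →ₗ[Γ(X, V)] (κ → Γ(X, V)))
    (hres : ∀ (V W : X.Opens) [Nonempty V] [Nonempty W] (h : V ≤ W) (v : ι → Γ(X, W)) (k : κ),
      φ V (fun i => resFun h (v i)) k = resFun h (φ W v k))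
    (hT : ∀ (c₁ c₂ : EtaleChart K X N) (V : X.Opens) [Nonempty V] (h₁ : V ≤ c₁.U) (h₂ : V ≤ c₂.U)
      (v : ι → Γ(X, V)), φ V (P.T c₁ c₂ V h₁ h₂ v) = Q.T c₁ c₂ V h₁ h₂ (φ V v)) :
    P.sheaf ⟶ Q.sheaf :=
  Scheme.Modules.homMk
    (fun W =>
      { toFun := fun s => (⟨fun p => φ p.V ((s : P.sections W).1 p), fun p q h => by
          let s' : P.sections W := s
          change Q.T _ _ _ _ _ (fun k => resFun h (φ p.V (s'.1 p) k)) = φ q.V (s'.1 q)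
          rw [← s'.2 p q h, hT]
          congr 1
          ext1 k
          rw [hres]⟩ : Q.sections W)
        map_add' := fun s t => Subtype.ext <| funext fun p => map_add (φ p.V) _ _
        map_smul' := fun a s => Subtype.ext <| funext fun p =>
          map_smul (φ p.V) (resFun p.le a) ((s : P.sections W).1 p) })
    fun _ _ _ _ => rfl

lemma triv_hom_app (φ : ∀ (V : X.Opens) [Nonempty V], (ι → Γ(X, V)) →ₗ[Γ(X, V)] (κ → Γ(X, V)))
    (hres : ∀ (V W : X.Opens) [Nonempty V] [Nonempty W] (h : V ≤ W) (v : ι → Γ(X, W)) (k : κ),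
      φ V (fun i => resFun h (v i)) k = resFun h (φ W v k))
    (hT : ∀ (c₁ c₂ : EtaleChart K X N) (V : X.Opens) [Nonempty V] (h₁ : V ≤ c₁.U) (h₂ : V ≤ c₂.U)
      (v : ι → Γ(X, V)), φ V (P.T c₁ c₂ V h₁ h₂ v) = Q.T c₁ c₂ V h₁ h₂ (φ V v))
    (c : EtaleChart K X N) (W : X.Opens) (hW : W ≤ c.U) [Nonempty W] (s : Γ(P.sheaf, W)) :
    Q.triv c W hW ((hom φ hres hT).app W s) = φ W (P.triv c W hW s) := by
  rw [triv_apply, triv_apply]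
  rfl

end ChartCocycle

end Glue
end

noncomputable section

/-! ### The bundle of formal vector fields and its filtration -/

/-- The pairs `(p, m)` with `|m| > r`, which index the fields `X^m ∂/∂X_p` of degree at least `r`. -/
abbrev JetIndex (N r : ℕ) : Type := {pm : Fin N × (Fin N →₀ ℕ) // r < pm.2.degree}

lemma formalVFGE_antitone {N : ℕ} {A : Type u} [CommRing A] : Antitone (formalVFGE N A) :=
  fun _ _ h _ hv j m hm => hv j m (hm.trans h)

/-- Formal vector fields of degree at least `r` are given by their coefficients. -/
def jetEquiv (N : ℕ) (A : Type u) [CommRing A] (r : ℕ) :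
    (JetIndex N r → A) ≃ₗ[A] formalVFGE N A r where
  toFun a := ⟨fun j m => if h : r < m.degree then a ⟨(j, m), h⟩ else 0,
    fun j m hm => dif_neg hm.not_gt⟩
  map_add' a b := Subtype.ext <| funext fun j => MvPowerSeries.ext fun m => by
    change (if h : r < m.degree then (a + b) ⟨(j, m), h⟩ else 0) =
      (if h : r < m.degree then a ⟨(j, m), h⟩ else 0) +
        (if h : r < m.degree then b ⟨(j, m), h⟩ else 0)
    split_ifs <;> simp
  map_smul' t a := Subtype.ext <| funext fun j => MvPowerSeries.ext fun m => by
    change (if h : r < m.degree then t * a ⟨(j, m), h⟩ else 0) =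
      t * (if h : r < m.degree then a ⟨(j, m), h⟩ else 0)
    split_ifs <;> simp
  invFun v pm := MvPowerSeries.coeff pm.1.2 (v.1 pm.1.1)
  left_inv a := funext fun pm => dif_pos pm.2
  right_inv v := Subtype.ext <| funext fun j => MvPowerSeries.ext fun m => by
    change (if h : r < m.degree then MvPowerSeries.coeff m (v.1 j) else 0) = _
    split_ifs with h
    · rfl
    · exact (v.2 j m (not_lt.1 h)).symm

section

variable {N : ℕ} {A : Type u} [CommRing A] {r : ℕ}

lemma coeff_jetEquiv (a : JetIndex N r → A) (j : Fin N) (m : Fin N →₀ ℕ) :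
    MvPowerSeries.coeff m ((jetEquiv N A r a).1 j) =
      if h : r < m.degree then a ⟨(j, m), h⟩ else 0 := rfl

lemma jetEquiv_symm_apply (v : formalVFGE N A r) (pm : JetIndex N r) :
    (jetEquiv N A r).symm v pm = MvPowerSeries.coeff pm.1.2 (v.1 pm.1.1) := rfl

lemma map_jetEquiv {B : Type u} [CommRing B] (ρ : A →+* B) (a : JetIndex N r → A) (j : Fin N) :
    MvPowerSeries.map ρ ((jetEquiv N A r a).1 j) =
      (jetEquiv N B r fun pm => ρ (a pm)).1 j := by
  ext m
  rw [MvPowerSeries.coeff_map, coeff_jetEquiv, coeff_jetEquiv]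
  split_ifs <;> simp

end

section Bundle

variable (K : Type u) [Field K] [CharZero K] (X : Scheme.{u}) [X.Over (Spec (.of K))]
  [IsIntegral X] (N : ℕ)

omit [CharZero K] in
variable {K X N} in
lemma EtaleChart.transition_mem (c₁ c₂ : EtaleChart K X N) {V : X.Opens} [Nonempty V]
    (h₁ : V ≤ c₁.U) (h₂ : V ≤ c₂.U) {r : ℕ} (v : FormalVF N Γ(X, V))
    (hv : v ∈ formalVFGE N Γ(X, V) r) :
    c₁.transition c₂ h₁ h₂ v ∈ formalVFGE N Γ(X, V) r :=
  IsUniformizing.transition_mem _ _ hv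

/-- The transition maps between formal vector fields of degree at least `r`. -/
def jetCocycle (r : ℕ) : ChartCocycle K X N (JetIndex N r) where
  T c₁ c₂ V _ h₁ h₂ := (jetEquiv N Γ(X, V) r).symm.toLinearMap ∘ₗ
    (c₁.transition c₂ h₁ h₂).restrict (c₁.transition_mem c₂ h₁ h₂) ∘ₗ
      (jetEquiv N Γ(X, V) r).toLinearMap
  resFun_T c₁ c₂ V W _ _ h h₁ h₂ v pm := by
    simp only [LinearMap.comp_apply, LinearEquiv.coe_coe, jetEquiv_symm_apply,
      LinearMap.coe_restrict_apply]
    rw [← MvPowerSeries.coeff_map, EtaleChart.map_transition]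
    simp only [map_jetEquiv]
  T_self c V _ h v := by
    rw [LinearMap.comp_apply, LinearMap.comp_apply, LinearEquiv.coe_coe, LinearEquiv.coe_coe,
      LinearEquiv.symm_apply_eq]
    exact Subtype.ext (IsUniformizing.transition_self _ _)
  T_trans c₁ c₂ c₃ V _ h₁ h₂ h₃ v := by
    simp only [LinearMap.comp_apply, LinearEquiv.coe_coe, LinearEquiv.apply_symm_apply]
    congr 1
    exact Subtype.ext (IsUniformizing.transition_transition _ _ _ _)

variable {K X N}

lemma jetEquiv_jetCocycle (r : ℕ) (c₁ c₂ : EtaleChart K X N) (V : X.Opens) [Nonempty V]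
    (h₁ : V ≤ c₁.U) (h₂ : V ≤ c₂.U) (v : JetIndex N r → Γ(X, V)) :
    (jetEquiv N Γ(X, V) r ((jetCocycle K X N r).T c₁ c₂ V h₁ h₂ v)).1 =
      c₁.transition c₂ h₁ h₂ (jetEquiv N Γ(X, V) r v).1 := by
  change (jetEquiv N Γ(X, V) r ((jetEquiv N Γ(X, V) r).symm _)).1 = _
  rw [LinearEquiv.apply_symm_apply]
  rfl

variable (K X N)

/-- Fields of degree at least `s` among those of degree at least `r`. -/
def jetInclLinear (A : Type u) [CommRing A] {r s : ℕ} (h : r ≤ s) :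
    (JetIndex N s → A) →ₗ[A] (JetIndex N r → A) :=
  (jetEquiv N A r).symm.toLinearMap ∘ₗ
    Submodule.inclusion (formalVFGE_antitone h) ∘ₗ (jetEquiv N A s).toLinearMap

lemma jetEquiv_jetInclLinear (A : Type u) [CommRing A] {r s : ℕ} (h : r ≤ s)
    (v : JetIndex N s → A) :
    (jetEquiv N A r (jetInclLinear N A h v)).1 = (jetEquiv N A s v).1 := by
  change (jetEquiv N A r ((jetEquiv N A r).symm _)).1 = _
  rw [LinearEquiv.apply_symm_apply]
  rfl

lemma jetInclLinear_injective (A : Type u) [CommRing A] {r s : ℕ} (h : r ≤ s) :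
    Function.Injective (jetInclLinear N A h) := fun v w hvw => by
  apply (jetEquiv N A s).injective
  apply Subtype.ext
  rw [← jetEquiv_jetInclLinear N A h, hvw, jetEquiv_jetInclLinear]

/-- The inclusion of the bundle of fields of degree at least `s`. -/
def jetIncl {r s : ℕ} (h : r ≤ s) : (jetCocycle K X N s).sheaf ⟶ (jetCocycle K X N r).sheaf :=
  ChartCocycle.hom (fun V _ => jetInclLinear N Γ(X, V) h)
    (fun V W _ _ hVW v pm => by
      simp only [jetInclLinear, LinearMap.comp_apply, LinearEquiv.coe_coe, jetEquiv_symm_apply,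
        Submodule.coe_inclusion]
      rw [← MvPowerSeries.coeff_map, map_jetEquiv])
    (fun c₁ c₂ V _ h₁ h₂ v => by
      apply (jetEquiv N Γ(X, V) r).injective
      apply Subtype.ext
      simp only [jetEquiv_jetInclLinear, jetEquiv_jetCocycle])

lemma ChartCocycle.hom_app_injective {K : Type u} [Field K] {X : Scheme.{u}}
    [X.Over (Spec (.of K))] [IsIntegral X] {N : ℕ} {ι κ : Type} {P : ChartCocycle K X N ι}
    {Q : ChartCocycle K X N κ}
    (φ : ∀ (V : X.Opens) [Nonempty V], (ι → Γ(X, V)) →ₗ[Γ(X, V)] (κ → Γ(X, V)))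
    (hres) (hT) (hφ : ∀ (V : X.Opens) [Nonempty V], Function.Injective (φ V)) (W : X.Opens) :
    Function.Injective ((ChartCocycle.hom (P := P) (Q := Q) φ hres hT).app W) := fun _ _ hst =>
  Subtype.ext <| funext fun p => hφ p.V <|
    congrFun (congrArg (fun u : Q.sections W => u.1) hst) p

lemma AlgebraicGeometry.Scheme.Modules.app_congr {X : Scheme.{u}} {M M' : X.Modules}
    {f g : M ⟶ M'} (h : f = g) (W : X.Opens) (s : Γ(M, W)) : f.app W s = g.app W s := by
  rw [h]

lemma AlgebraicGeometry.Scheme.Modules.mono_of_injective {X : Scheme.{u}} {M M' : X.Modules}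
    (f : M ⟶ M') (hf : ∀ W : X.Opens, Function.Injective (f.app W)) : Mono f where
  right_cancellation g h hgh := by
    apply Scheme.Modules.hom_ext
    intro W
    ext s
    apply hf W
    exact Scheme.Modules.app_congr hgh W s

lemma jetIncl_injective {r s : ℕ} (h : r ≤ s) (W : X.Opens) :
    Function.Injective ((jetIncl K X N h).app W) :=
  ChartCocycle.hom_app_injective _ _ _ (fun _ _ => jetInclLinear_injective _ _ _) W

instance {r s : ℕ} (h : r ≤ s) : Mono (jetIncl K X N h) :=
  Scheme.Modules.mono_of_injective _ (jetIncl_injective K X N h)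

lemma jetIncl_comp {r s t : ℕ} (h : r ≤ s) (h' : s ≤ t) :
    jetIncl K X N h' ≫ jetIncl K X N h = jetIncl K X N (h.trans h') := by
  apply Scheme.Modules.hom_ext
  intro W
  ext v
  refine Subtype.ext <| funext fun p => ?_
  apply (jetEquiv N Γ(X, p.V) r).injective
  apply Subtype.ext
  change (jetEquiv N Γ(X, p.V) r (jetInclLinear N _ h (jetInclLinear N _ h' _))).1 =
    (jetEquiv N Γ(X, p.V) r (jetInclLinear N _ _ _)).1
  simp only [jetEquiv_jetInclLinear]

/-- An idempotent monomorphism is the identity. -/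
lemma jetIncl_self (r : ℕ) : jetIncl K X N (le_refl r) = 𝟙 _ := by
  rw [← cancel_mono (jetIncl K X N (le_refl r)), jetIncl_comp, Category.id_comp]

/-- The bundle of formal vector fields vanishing at the origin. -/
def formalVFBundle : LPlusBundle K X N where
  E := (jetCocycle K X N 0).sheaf
  triv c W hW := (jetCocycle K X N 0).triv c W hW ≪≫ₗ jetEquiv N Γ(X, W) 0
  triv_res c V W hV hW e j := by
    simp only [LinearEquiv.trans_apply]
    rw [map_jetEquiv]
    refine congrFun (congrArg Subtype.val (congrArg _ (funext fun pm => ?_))) j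
    exact (jetCocycle K X N 0).triv_map c hV hW e pm
  continuous_transition c₁ c₂ W h₁ h₂ r := by
    -- The transition maps preserve the degree filtration, so the same degree works.
    refine ⟨r, fun v hv => ?_⟩
    by_cases hne : Nonempty W
    · change (jetEquiv N Γ(X, W) 0 ((jetCocycle K X N 0).triv c₂ W h₂
        (((jetCocycle K X N 0).triv c₁ W h₁).symm ((jetEquiv N Γ(X, W) 0).symm v)))).1 ∈ _
      rw [ChartCocycle.triv_triv_symm, jetEquiv_jetCocycle, LinearEquiv.apply_symm_apply]
      exact IsUniformizing.transition_mem _ _ hv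
    · have := subsingleton_sections hne
      exact fun j m _ => Subsingleton.elim _ _

lemma formalVFBundle_triv_symm (c₁ c₂ : EtaleChart K X N) (W : X.Opens) (h₁ : W ≤ c₁.U)
    (h₂ : W ≤ c₂.U) [Nonempty W] (v : LPlus N Γ(X, W)) :
    ((formalVFBundle K X N).triv c₂ W h₂ (((formalVFBundle K X N).triv c₁ W h₁).symm v)).1 =
      c₁.transition c₂ h₁ h₂ v.1 := by
  change (jetEquiv N Γ(X, W) 0 ((jetCocycle K X N 0).triv c₂ W h₂
    (((jetCocycle K X N 0).triv c₁ W h₁).symm ((jetEquiv N Γ(X, W) 0).symm v)))).1 = _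
  rw [ChartCocycle.triv_triv_symm, jetEquiv_jetCocycle, LinearEquiv.apply_symm_apply]

lemma hasTransitionFormula_formalVFBundle : (formalVFBundle K X N).HasTransitionFormula := by
  intro c₁ c₂
  have := c₁.nonempty
  have := c₂.nonempty
  have := nonempty_inf c₁.U c₂.U
  refine ⟨c₁.uniformizing inf_le_left, c₂.uniformizing inf_le_right, fun m hm p => ?_⟩
  rw [formalVFBundle_triv_symm]
  exact IsUniformizing.transition_monomial _ _ _ _ _

/-- The filtration by degree. -/
def degreeFiltration (r : ℕ) : Subobject (formalVFBundle K X N).E :=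
  (Subobject.mk (jetIncl K X N (Nat.zero_le r)) : Subobject (jetCocycle K X N 0).sheaf)

/-- The object underlying a subobject is only isomorphic to the chosen monomorphism's source;
sections are carried along this isomorphism. -/
lemma exists_degreeFiltration_iff (r : ℕ) (W : X.Opens) (e : Γ((formalVFBundle K X N).E, W)) :
    (∃ e' : Γ((degreeFiltration K X N r : X.Modules), W),
      (degreeFiltration K X N r).arrow.app W e' = e) ↔
    ∃ e' : Γ((jetCocycle K X N r).sheaf, W), (jetIncl K X N (Nat.zero_le r)).app W e' = e := by
  constructor
  · rintro ⟨e', rfl⟩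
    refine ⟨(Subobject.underlyingIso (jetIncl K X N (Nat.zero_le r))).hom.app W e', ?_⟩
    have := Subobject.underlyingIso_hom_comp_eq_mk (jetIncl K X N (Nat.zero_le r))
    exact Scheme.Modules.app_congr this W e'
  · rintro ⟨e', rfl⟩
    refine ⟨(Subobject.underlyingIso (jetIncl K X N (Nat.zero_le r))).inv.app W e', ?_⟩
    have := Subobject.underlyingIso_arrow (jetIncl K X N (Nat.zero_le r))
    exact Scheme.Modules.app_congr this W e'

/-- In a chart the morphism is the inclusion of the fields of degree at least `r`, and every such
field comes from a section through the inverse trivialization. -/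
lemma exists_jetIncl_iff (r : ℕ) (c : EtaleChart K X N) (W : X.Opens) (hW : W ≤ c.U)
    (e : Γ((formalVFBundle K X N).E, W)) :
    (∃ e' : Γ((jetCocycle K X N r).sheaf, W), (jetIncl K X N (Nat.zero_le r)).app W e' = e) ↔
      ((formalVFBundle K X N).triv c W hW e).1 ∈ formalVFGE N Γ(X, W) r := by
  by_cases hne : Nonempty W
  · have key : ∀ e' : Γ((jetCocycle K X N r).sheaf, W),
        ((formalVFBundle K X N).triv c W hW ((jetIncl K X N (Nat.zero_le r)).app W e')).1 =
          (jetEquiv N _ r ((jetCocycle K X N r).triv c W hW e')).1 := by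
      intro e'
      rw [← jetEquiv_jetInclLinear N _ (Nat.zero_le r)]
      change (jetEquiv N Γ(X, W) 0 ((jetCocycle K X N 0).triv c W hW _)).1 = _
      congr 2
      exact ChartCocycle.triv_hom_app _ _ _ c W hW e'
    constructor
    · rintro ⟨e', rfl⟩
      rw [key]
      exact Subtype.property _
    · intro h
      refine ⟨((jetCocycle K X N r).triv c W hW).symm ((jetEquiv N _ r).symm ⟨_, h⟩), ?_⟩
      apply ((formalVFBundle K X N).triv c W hW).injective
      apply Subtype.ext
      rw [key, LinearEquiv.apply_symm_apply, LinearEquiv.apply_symm_apply]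
  · have := subsingleton_sections hne
    refine iff_of_true ⟨0, ?_⟩ fun j m _ => Subsingleton.elim _ _
    apply ((formalVFBundle K X N).triv c W hW).injective
    exact Subtype.ext (funext fun j => MvPowerSeries.ext fun m => Subsingleton.elim _ _)

lemma isDegreeFiltration_degreeFiltration :
    (formalVFBundle K X N).IsDegreeFiltration (degreeFiltration K X N) where
  antitone r s h := Subobject.mk_le_mk_of_comm (jetIncl K X N h) (jetIncl_comp K X N (Nat.zero_le r) h)
  zero := by
    have : IsIso (jetIncl K X N (Nat.zero_le 0)) := by
      rw [jetIncl_self]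
      infer_instance
    exact Subobject.mk_eq_top_of_isIso (jetIncl K X N (Nat.zero_le 0))
  mem_iff r c W hW e := (exists_degreeFiltration_iff K X N r W e).trans
    (exists_jetIncl_iff K X N r c W hW e)

end Bundle
end

noncomputable section

/-! ### Quotients of sheaves of modules which are free -/

namespace AlgebraicGeometry.Scheme.Modules

variable {Y : Scheme.{u}} {F G M : Y.Modules}

/-- Passing to presheaves preserves monomorphisms, and a monomorphism of presheaves is injective on
sections. -/
lemma injective_app_of_mono (i : F ⟶ M) [Mono i] (W : Y.Opens) :
    Function.Injective (i.app W) := by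
  have : Mono ((toPresheaf Y).map i) := inferInstance
  have := (NatTrans.mono_iff_mono_app ((toPresheaf Y).map i)).1 this (op W)
  exact (AddCommGrpCat.mono_iff_injective _).1 this

/-- A morphism whose values on sections lie in a subsheaf factors through it. -/
lemma exists_lift (i : F ⟶ M) [Mono i] (g : G ⟶ M)
    (h : ∀ (W : Y.Opens) (s : Γ(G, W)), ∃ t : Γ(F, W), i.app W t = g.app W s) :
    ∃ l : G ⟶ F, l ≫ i = g := by
  -- The chosen preimages are unique by injectivity of `i` on sections, hence automatically linear
  -- and compatible with restriction.
  choose t ht using h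
  refine ⟨homMk (fun W => { toFun := t W, map_add' := fun a b => ?_, map_smul' := fun a b => ?_ })
    fun V W hVW s => ?_, ?_⟩
  · apply injective_app_of_mono i W
    rw [map_add, ht, ht, ht, map_add]
  · apply injective_app_of_mono i W
    rw [RingHom.id_apply, Hom.app_smul, ht, ht, Hom.app_smul]
  · apply injective_app_of_mono i V
    have h₁ := congr($(i.mapPresheaf.naturality (homOfLE hVW).op) (t W s))
    have h₂ := congr($(g.mapPresheaf.naturality (homOfLE hVW).op) s)
    refine (ht V _).trans (h₂.trans (Eq.trans ?_ h₁.symm))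
    exact congrArg (M.presheaf.map (homOfLE hVW).op) (ht W s).symm
  · apply hom_ext
    intro W
    ext s
    exact ht W s

variable (Y) in
/-- The structure sheaf as a sheaf of modules. -/
abbrev unit : Y.Modules := SheafOfModules.unit Y.ringCatSheaf

variable (Y) in
/-- The free sheaf of modules. -/
abbrev free (I : Type u) : Y.Modules := SheafOfModules.free (R := Y.ringCatSheaf) I

/-- The coprojections of the free sheaf of modules. -/
def freeι {I : Type u} (i : I) : unit Y ⟶ free Y I := SheafOfModules.ιFree i

lemma free_hom_ext {I : Type u} {f g : free Y I ⟶ M} (h : ∀ i, freeι i ≫ f = freeι i ≫ g) :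
    f = g :=
  Cofan.IsColimit.hom_ext (SheafOfModules.isColimitFreeCofan (R := Y.ringCatSheaf) I) _ _ h

/-- A section `a` is `a` times the restriction of the global section `1`, so linearity and
naturality determine its image. -/
lemma unit_hom_ext {f g : unit Y ⟶ M} (h : f.app ⊤ (1 : Γ(Y, ⊤)) = g.app ⊤ (1 : Γ(Y, ⊤))) :
    f = g := by
  apply hom_ext
  intro W
  ext (a : Γ(Y, W))
  have key : ∀ k : unit Y ⟶ M, k.app W a =
      a • M.presheaf.map (homOfLE (le_top : W ≤ ⊤)).op (k.app ⊤ (1 : Γ(Y, ⊤))) := by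
    intro k
    have h₁ := congr($(k.mapPresheaf.naturality (homOfLE (le_top : W ≤ ⊤)).op) (1 : Γ(Y, ⊤)))
    refine Eq.trans ?_ (congrArg (a • ·) h₁)
    refine Eq.trans ?_ (Hom.app_smul k a _)
    congr 1
    exact ((congrArg (a * ·) (map_one (Y.presheaf.map (homOfLE (le_top : W ≤ ⊤)).op).hom)).trans
      (mul_one a)).symm
  exact (key f).trans ((congrArg _ (congrArg _ h)).trans (key g).symm)

/-- The morphism from a free sheaf of modules given by global sections. -/
def freeDesc {I : Type u} (s : I → Γ(M, ⊤)) : free Y I ⟶ M :=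
  (SheafOfModules.freeHomEquiv (R := Y.ringCatSheaf) M).symm fun i =>
    PresheafOfModules.sectionsMk (fun W => M.presheaf.map (homOfLE (le_top : W.unop ≤ ⊤)).op (s i))
      fun V W f => by
        change (M.presheaf.map _ ≫ M.presheaf.map f) (s i) = _
        rw [← Functor.map_comp]
        rfl

lemma freeι_freeDesc_app_top {I : Type u} (s : I → Γ(M, ⊤)) (i : I) :
    (freeι i ≫ freeDesc s).app ⊤ (1 : Γ(Y, ⊤)) = s i := by
  have := congrFun ((SheafOfModules.freeHomEquiv (R := Y.ringCatSheaf) M).apply_symm_apply fun i =>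
    PresheafOfModules.sectionsMk (fun W => M.presheaf.map (homOfLE (le_top : W.unop ≤ ⊤)).op (s i))
      fun V W f => by
        change (M.presheaf.map _ ≫ M.presheaf.map f) (s i) = _
        rw [← Functor.map_comp]
        rfl) i
  refine (congrArg (fun t => t.1 (op ⊤)) this).trans ?_
  change M.presheaf.map (𝟙 _) (s i) = _
  simp

/-- A subsheaf which is the common kernel of finitely many linear forms that have a dual family of
sections has a free quotient. -/
lemma nonempty_cokernel_iso_free {I : Type} [Finite I] (i : F ⟶ M) [Mono i]
    (α : I → (M ⟶ unit Y)) (b : I → Γ(M, ⊤))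
    (hb : ∀ j, (α j).app ⊤ (b j) = (1 : Γ(Y, ⊤))) (hb' : ∀ j k, j ≠ k → (α j).app ⊤ (b k) = 0)
    (hi : ∀ j, i ≫ α j = 0)
    (h : ∀ (W : Y.Opens) (s : Γ(M, W)), (∀ j, (α j).app W s = 0) →
      ∃ t : Γ(F, W), i.app W t = s) :
    Nonempty (cokernel i ≅ free Y (ULift.{u} I)) := by
  classical
  have := Fintype.ofFinite I
  let s : free Y (ULift.{u} I) ⟶ M := freeDesc fun j => b j.down
  let p : M ⟶ free Y (ULift.{u} I) := ∑ j : I, α j ≫ freeι ⟨j⟩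
  have hsα : ∀ j k : I, freeι ⟨k⟩ ≫ s ≫ α j = if j = k then 𝟙 (unit Y) else 0 := by
    intro j k
    apply unit_hom_ext
    rw [← Category.assoc, Hom.comp_app]
    have h₁ : (freeι ⟨k⟩ ≫ s).app ⊤ (1 : Γ(Y, ⊤)) = b k :=
      freeι_freeDesc_app_top (fun j : ULift.{u} I => b j.down) ⟨k⟩
    refine (congrArg ((α j).app ⊤) h₁).trans ?_
    split_ifs with hjk
    · subst hjk
      exact hb j
    · exact hb' j k hjk
  have hsp : s ≫ p = 𝟙 _ := by
    apply free_hom_ext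
    rintro ⟨k⟩
    have : ∀ j : I, freeι ⟨k⟩ ≫ s ≫ α j ≫ freeι ⟨j⟩ =
        if j = k then freeι (⟨k⟩ : ULift.{u} I) else 0 := by
      intro j
      have := congrArg (· ≫ freeι (⟨j⟩ : ULift.{u} I)) (hsα j k)
      simp only [Category.assoc] at this
      rw [this]
      split_ifs with hjk
      · subst hjk
        exact Category.id_comp _
      · exact zero_comp
    rw [Category.comp_id, Preadditive.comp_sum, Preadditive.comp_sum]
    simp only [this]
    simp
  -- The projector `𝟙 M - p ≫ s` is killed by all the linear forms and so factors through `i`.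
  -- Together with `s ≫ p = 𝟙` this exhibits `p` as a cokernel of `i`.
  have hpsα : ∀ j : I, (𝟙 M - p ≫ s) ≫ α j = 0 := by
    intro j
    have : ∀ k : I, (α k ≫ freeι (⟨k⟩ : ULift.{u} I)) ≫ s ≫ α j = if j = k then α k else 0 := by
      intro k
      rw [Category.assoc, hsα]
      split_ifs
      · exact Category.comp_id _
      · exact comp_zero
    rw [Preadditive.sub_comp, Category.id_comp, Category.assoc, Preadditive.sum_comp]
    simp only [this]
    simp
  obtain ⟨l, hl⟩ := exists_lift i (𝟙 M - p ≫ s) fun W e => h W _ fun j =>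
    app_congr (hpsα j) W e
  have hip : i ≫ p = 0 := by
    rw [Preadditive.comp_sum]
    exact Finset.sum_eq_zero fun j _ => by rw [← Category.assoc, hi, zero_comp]
  have hc : IsColimit (CokernelCofork.ofπ p hip) :=
    CokernelCofork.IsColimit.ofπ p hip (fun k _ => s ≫ k)
      (fun k hk => by
        have : (𝟙 M - p ≫ s) ≫ k = 0 := by rw [← hl, Category.assoc, hk, comp_zero]
        rw [Preadditive.sub_comp, Category.id_comp, sub_eq_zero] at this
        rw [← Category.assoc, ← this])
      (fun k hk m hm => by rw [← hm, ← Category.assoc, hsp, Category.id_comp])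
  exact ⟨(cokernelIsCokernel i).coconePointUniqueUpToIso hc⟩

end AlgebraicGeometry.Scheme.Modules
end

/-! ### Freeness of the quotients over a chart. -/

noncomputable section

instance finite_degree_le (N r : ℕ) : Finite {m : Fin N →₀ ℕ // m ≠ 0 ∧ m.degree ≤ r} := by
  refine Set.Finite.subset
    (Set.finite_Iic (Finsupp.equivFunOnFinite.symm fun _ : Fin N => r)) fun m hm => ?_
  intro i
  exact (Finsupp.le_degree i m).trans hm.2

/-- Scalar multiplication on the restriction to an open subscheme. -/
lemma AlgebraicGeometry.Scheme.Modules.restrict_ι_smul {X : Scheme.{u}} (U : X.Opens)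
    (M : X.Modules) (W : (U : Scheme.{u}).Opens) (a : Γ(X, U.ι ''ᵁ W)) (s : Γ(M, U.ι ''ᵁ W)) :
    ((show Γ((U : Scheme.{u}), W) from a) • (show Γ(M.restrict U.ι, W) from s) :
      Γ(M.restrict U.ι, W)) = a • s := by
  change (show Γ(X, U.ι ''ᵁ W) from (U.ι.appIso W).inv a) • s = _
  rw [Scheme.Opens.ι_appIso]
  rfl

section Quotient

variable {K : Type u} [Field K] {X : Scheme.{u}} [X.Over (Spec (.of K))] {N : ℕ}

/-- A coefficient of the formal vector fields, as a linear form on the restriction of the bundle to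
a chart. -/
def LPlusBundle.coeffForm (L : LPlusBundle K X N) (c : EtaleChart K X N) (m : Fin N →₀ ℕ)
    (p : Fin N) : L.E.restrict c.U.ι ⟶ Scheme.Modules.unit (c.U : Scheme.{u}) :=
  Scheme.Modules.homMk (X := (c.U : Scheme.{u}))
    (fun W =>
      { toFun := fun s : Γ(L.E, c.U.ι ''ᵁ W) =>
          (MvPowerSeries.coeff m ((L.triv c (c.U.ι ''ᵁ W) (c.U.ι_image_le W) s).1 p) :
            Γ(X, c.U.ι ''ᵁ W))
        map_add' := fun s t => by
          exact (congrArg (fun v : LPlus N Γ(X, c.U.ι ''ᵁ W) => MvPowerSeries.coeff m (v.1 p))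
            (map_add (L.triv c (c.U.ι ''ᵁ W) (c.U.ι_image_le W)) _ _)).trans rfl
        map_smul' := fun a s => by
          refine (congrArg (fun t : Γ(L.E, c.U.ι ''ᵁ W) => MvPowerSeries.coeff m
            ((L.triv c (c.U.ι ''ᵁ W) (c.U.ι_image_le W) t).1 p))
            (Scheme.Modules.restrict_ι_smul c.U L.E W a s)).trans ?_
          exact congrArg (fun v : LPlus N Γ(X, c.U.ι ''ᵁ W) => MvPowerSeries.coeff m (v.1 p))
            ((L.triv c (c.U.ι ''ᵁ W) (c.U.ι_image_le W)).map_smul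
              (show Γ(X, c.U.ι ''ᵁ W) from a) s) })
    fun V W h s => by
      refine (congrArg (MvPowerSeries.coeff m) (L.triv_res c _ _ (c.U.ι.image_mono h)
        (c.U.ι_image_le W) s p)).trans ?_
      exact MvPowerSeries.coeff_map _ _ _

lemma LPlusBundle.coeffForm_app (L : LPlusBundle K X N) (c : EtaleChart K X N) (m : Fin N →₀ ℕ)
    (p : Fin N) (W : (c.U : Scheme.{u}).Opens) (s : Γ(L.E, c.U.ι ''ᵁ W)) :
    (L.coeffForm c m p).app W s =
      MvPowerSeries.coeff m ((L.triv c (c.U.ι ''ᵁ W) (c.U.ι_image_le W) s).1 p) := rfl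

/-- The coefficients with `1 ≤ |m| ≤ r` are finitely many linear forms, dual to the monomial fields,
and their common kernel is the `r`-th step of the filtration. Restriction to the chart preserves the
cokernel. -/
lemma LPlusBundle.IsDegreeFiltration.quotientIsVectorBundle {L : LPlusBundle K X N}
    {F : ℕ → Subobject L.E} (hF : L.IsDegreeFiltration F) (r : ℕ) :
    L.QuotientIsVectorBundle r (F r) := by
  intro c
  let R := Scheme.Modules.restrictFunctor c.U.ι
  have : Mono (R.map (F r).arrow) := Scheme.Modules.mono_of_injective _ fun W =>
    Scheme.Modules.injective_app_of_mono (F r).arrow (c.U.ι ''ᵁ W)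
  have hmem := fun (W : (c.U : Scheme.{u}).Opens) (s : Γ(L.E, c.U.ι ''ᵁ W)) =>
    hF.mem_iff r c (c.U.ι ''ᵁ W) (c.U.ι_image_le W) s
  obtain ⟨e⟩ := Scheme.Modules.nonempty_cokernel_iso_free (R.map (F r).arrow)
    (I := {m : Fin N →₀ ℕ // m ≠ 0 ∧ m.degree ≤ r} × Fin N)
    (fun j => L.coeffForm c j.1.1 j.2)
    (fun j => (L.triv c (c.U.ι ''ᵁ ⊤) (c.U.ι_image_le ⊤)).symm
      (LPlus.monomial _ j.1.1 j.1.2.1 j.2))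
    (fun j => by
      refine (L.coeffForm_app c _ _ _ _).trans ?_
      rw [LinearEquiv.apply_symm_apply]
      simp only [LPlus.monomial, Pi.single_eq_same, MvPowerSeries.coeff_monomial_same]
      rfl)
    (fun j k hjk => by
      classical
      refine (L.coeffForm_app c _ _ _ _).trans ?_
      rw [LinearEquiv.apply_symm_apply]
      by_cases h : j.2 = k.2
      · have : j.1.1 ≠ k.1.1 := fun h' => hjk (Prod.ext (Subtype.ext h') h)
        simp only [LPlus.monomial, h, Pi.single_eq_same, MvPowerSeries.coeff_monomial_ne this]
        rfl
      · simp only [LPlus.monomial, Pi.single_eq_of_ne h, map_zero]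
        rfl)
    (fun j => by
      apply Scheme.Modules.hom_ext
      intro W
      ext s
      exact (hmem W _).1 ⟨s, rfl⟩ _ _ j.1.2.2)
    (fun W s hs => (hmem W s).2 fun j m hm => by
      -- The constant term is not among the linear forms, but it vanishes for every section of the
      -- bundle.
      by_cases h : m = 0
      · exact Subtype.property (L.triv c _ _ s) j m (by simp [h])
      · exact hs (⟨m, h, hm⟩, j))
  exact ⟨PreservesCokernel.iso R (F r).arrow ≪≫ e⟩

end Quotient
end

noncomputable section

/-! ### The bundle of linear parts -/

section LinearPart

variable (N : ℕ) (A : Type u) [CommRing A]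

/-- The matrix of the linear part of a formal vector field. -/
def linearPart : (JetIndex N 0 → A) →ₗ[A] (Fin N × Fin N → A) where
  toFun v ij := MvPowerSeries.coeff (Finsupp.single ij.1 1) ((jetEquiv N A 0 v).1 ij.2)
  map_add' v w := by
    ext1 ij
    simp
  map_smul' a v := by
    ext1 ij
    simp

variable {N A}

lemma linearPart_apply (v : JetIndex N 0 → A) (ij : Fin N × Fin N) :
    linearPart N A v ij =
      MvPowerSeries.coeff (Finsupp.single ij.1 1) ((jetEquiv N A 0 v).1 ij.2) := rfl

/-- Besides local surjectivity, this transfers the cocycle identities from vector fields to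
matrices. -/
lemma linearPart_surjective : Function.Surjective (linearPart N A) := by
  classical
  intro a
  refine ⟨fun pm => ∑ i, if pm.1.2 = Finsupp.single i 1 then a (i, pm.1.1) else 0, ?_⟩
  ext1 ij
  rw [linearPart_apply, coeff_jetEquiv, dif_pos (by simp)]
  simp [Finsupp.single_left_inj]

/-- Constant terms are absent already; without the linear terms all components start in degree 2,
that is, the field has degree at least 1. -/
lemma linearPart_eq_zero_iff (v : JetIndex N 0 → A) :
    linearPart N A v = 0 ↔ v ∈ Set.range (jetInclLinear N A (Nat.zero_le 1)) := by
  constructor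
  · intro h
    have hv : (jetEquiv N A 0 v).1 ∈ formalVFGE N A 1 := by
      intro j m hm
      rcases Nat.lt_or_ge 0 m.degree with h0 | h0
      · obtain ⟨i, n, rfl⟩ := Finsupp.exists_eq_add_single (m := m) (by
          rintro rfl
          simp at h0)
        obtain rfl : n = 0 := by
          rw [← Finsupp.degree_eq_zero_iff]
          simpa using hm
        rw [zero_add]
        exact congrFun h (i, j)
      · exact (jetEquiv N A 0 v).2 j m h0
    refine ⟨(jetEquiv N A 1).symm ⟨_, hv⟩, ?_⟩
    apply (jetEquiv N A 0).injective
    apply Subtype.ext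
    rw [jetEquiv_jetInclLinear, LinearEquiv.apply_symm_apply]
  · rintro ⟨w, rfl⟩
    ext1 ij
    rw [linearPart_apply, jetEquiv_jetInclLinear]
    exact (jetEquiv N A 1 w).2 _ _ (by simp)

end LinearPart

section Bundle

variable (K : Type u) [Field K] [CharZero K] (X : Scheme.{u}) [X.Over (Spec (.of K))]
  [IsIntegral X] (N : ℕ)

variable {K X N} in
/-- The change of the matrix of a `(1,1)`-tensor between two charts. -/
def EtaleChart.matrixTransition (c₁ c₂ : EtaleChart K X N) {V : X.Opens} [Nonempty V]
    (h₁ : V ≤ c₁.U) (h₂ : V ≤ c₂.U) :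
    (Fin N × Fin N → Γ(X, V)) →ₗ[Γ(X, V)] (Fin N × Fin N → Γ(X, V)) where
  toFun a kl := ∑ j, ∑ i, a (i, j) * (c₂.uniformizing h₂).pderiv kl.1 (c₁.param h₁ i) *
    (c₁.uniformizing h₁).pderiv j (c₂.param h₂ kl.2)
  map_add' a b := by
    ext1 kl
    simp [add_mul, Finset.sum_add_distrib]
  map_smul' t a := by
    ext1 kl
    simp [mul_assoc, Finset.mul_sum]

variable {K X N} in
lemma linearPart_jetCocycle (c₁ c₂ : EtaleChart K X N) {V : X.Opens} [Nonempty V]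
    (h₁ : V ≤ c₁.U) (h₂ : V ≤ c₂.U) (v : JetIndex N 0 → Γ(X, V)) :
    linearPart N _ ((jetCocycle K X N 0).T c₁ c₂ V h₁ h₂ v) =
      c₁.matrixTransition c₂ h₁ h₂ (linearPart N _ v) := by
  ext1 kl
  rw [linearPart_apply, jetEquiv_jetCocycle]
  exact IsUniformizing.coeff_single_transition _ _ (jetEquiv N _ 0 v).2 _ _

/-- The transition maps between matrices of `(1,1)`-tensors. -/
def matrixCocycle : ChartCocycle K X N (Fin N × Fin N) where
  T c₁ c₂ V _ h₁ h₂ := c₁.matrixTransition c₂ h₁ h₂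
  resFun_T c₁ c₂ V W _ _ h h₁ h₂ a kl := by
    simp only [EtaleChart.matrixTransition, LinearMap.coe_mk, AddHom.coe_mk, map_sum, map_mul,
      EtaleChart.resFun_pderiv, EtaleChart.resFun_param]
  T_self c V _ h a := by
    -- Every matrix is a linear part, and linear parts intertwine the two kinds of transition maps,
    -- so the identity is inherited from vector fields.
    obtain ⟨v, rfl⟩ := linearPart_surjective a
    rw [← linearPart_jetCocycle, ChartCocycle.T_self]
  T_trans c₁ c₂ c₃ V _ h₁ h₂ h₃ a := by
    obtain ⟨v, rfl⟩ := linearPart_surjective a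
    rw [← linearPart_jetCocycle, ← linearPart_jetCocycle, ChartCocycle.T_trans,
      linearPart_jetCocycle]

/-- The linear part, as a morphism of sheaves of modules. -/
def linearPartHom : (jetCocycle K X N 0).sheaf ⟶ (matrixCocycle K X N).sheaf :=
  ChartCocycle.hom (fun V _ => linearPart N Γ(X, V))
    (fun V W _ _ h v ij => by
      rw [linearPart_apply, linearPart_apply, ← MvPowerSeries.coeff_map, map_jetEquiv])
    (fun c₁ c₂ V _ h₁ h₂ v => linearPart_jetCocycle c₁ c₂ h₁ h₂ v)

lemma jetIncl_linearPartHom : jetIncl K X N (Nat.zero_le 1) ≫ linearPartHom K X N = 0 := by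
  apply Scheme.Modules.hom_ext
  intro W
  ext v
  exact Subtype.ext <| funext fun p => (linearPart_eq_zero_iff _).2 ⟨_, rfl⟩

/-- Preimages exist separately in each chart; the inclusion is injective, so they are unique and
hence form a compatible family. -/
lemma exists_jetIncl_of_linearPartHom {W : X.Opens} (e : Γ((jetCocycle K X N 0).sheaf, W))
    (he : (linearPartHom K X N).app W e = 0) :
    ∃ e' : Γ((jetCocycle K X N 1).sheaf, W), (jetIncl K X N (Nat.zero_le 1)).app W e' = e := by
  let s : (jetCocycle K X N 0).sections W := e
  have h : ∀ p : ChartOpen K X N W,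
      ∃ w, jetInclLinear N Γ(X, p.V) (Nat.zero_le 1) w = s.1 p := fun p =>
    (linearPart_eq_zero_iff _).1
      (congrFun (congrArg (fun u : (matrixCocycle K X N).sections W => u.1) he) p)
  choose w hw using h
  refine ⟨(⟨w, fun p q hqp => ?_⟩ : (jetCocycle K X N 1).sections W),
    Subtype.ext (funext hw)⟩
  apply jetInclLinear_injective N _ (Nat.zero_le 1)
  rw [hw, ← s.2 p q hqp, ← hw]
  apply (jetEquiv N Γ(X, q.V) 0).injective
  apply Subtype.ext
  rw [jetEquiv_jetInclLinear, jetEquiv_jetCocycle, jetEquiv_jetCocycle]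
  congr 1
  ext1 j
  rw [← map_jetEquiv, ← map_jetEquiv, jetEquiv_jetInclLinear]

lemma AlgebraicGeometry.Scheme.Modules.section_ext {Y : Scheme.{u}} {M : Y.Modules}
    {W : Y.Opens} {s t : Γ(M, W)}
    (h : ∀ x ∈ W, ∃ (V : Y.Opens) (hV : V ≤ W), x ∈ V ∧
      M.presheaf.map (homOfLE hV).op s = M.presheaf.map (homOfLE hV).op t) : s = t := by
  choose V hV hx hst using h
  refine TopCat.Sheaf.eq_of_locally_eq' ⟨M.presheaf, M.isSheaf⟩ (fun x : W => V x.1 x.2) W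
    (fun x => homOfLE (hV x.1 x.2)) ?_ s t fun x => hst x.1 x.2
  intro x hxW
  exact TopologicalSpace.Opens.mem_iSup.2 ⟨⟨x, hxW⟩, hx x hxW⟩

/-- A morphism of sheaves of modules which is locally surjective is an epimorphism. -/
lemma AlgebraicGeometry.Scheme.Modules.epi_of_locally_surjective {Y : Scheme.{u}}
    {M M' : Y.Modules} (f : M ⟶ M')
    (h : ∀ (W : Y.Opens) (s : Γ(M', W)), ∀ x ∈ W, ∃ (V : Y.Opens) (hV : V ≤ W), x ∈ V ∧
      ∃ t : Γ(M, V), f.app V t = M'.presheaf.map (homOfLE hV).op s) : Epi f where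
  left_cancellation {Z} g k hgk := by
    apply Scheme.Modules.hom_ext
    intro W
    ext s
    apply Scheme.Modules.section_ext
    intro x hx
    obtain ⟨V, hV, hxV, t, ht⟩ := h W s x hx
    refine ⟨V, hV, hxV, ?_⟩
    have key : ∀ l : M' ⟶ Z, Z.presheaf.map (homOfLE hV).op (l.app W s) = l.app V (f.app V t) := by
      intro l
      rw [ht]
      exact congr($(l.mapPresheaf.naturality (homOfLE hV).op) s).symm
    exact (key g).trans ((Scheme.Modules.app_congr hgk V t).trans (key k).symm)

/-- Étale charts cover the smooth scheme, and over a chart the map on sections is the surjective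
linear part. -/
instance epi_linearPartHom [SmoothOfRelativeDimension N (X ↘ Spec (.of K))] : Epi (linearPartHom K X N) := by
  apply Scheme.Modules.epi_of_locally_surjective
  intro W s x hx
  obtain ⟨c, hc⟩ := exists_etaleChart (K := K) (N := N) x
  have hne : Nonempty (W ⊓ c.U : X.Opens) := ⟨⟨x, hx, hc⟩⟩
  refine ⟨W ⊓ c.U, inf_le_left, ⟨hx, hc⟩, ?_⟩
  obtain ⟨v, hv⟩ := linearPart_surjective ((matrixCocycle K X N).triv c (W ⊓ c.U) inf_le_right
    ((matrixCocycle K X N).sheaf.presheaf.map (homOfLE inf_le_left).op s))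
  refine ⟨((jetCocycle K X N 0).triv c _ inf_le_right).symm v, ?_⟩
  apply ((matrixCocycle K X N).triv c _ inf_le_right).injective
  refine (ChartCocycle.triv_hom_app _ _ _ c _ inf_le_right _).trans ?_
  rw [LinearEquiv.apply_symm_apply, hv]

variable {K X N}

lemma degreeFiltration_arrow_comp {r : ℕ} {M : X.Modules} {f : (jetCocycle K X N 0).sheaf ⟶ M} :
    (degreeFiltration K X N r).arrow ≫ f = 0 ↔ jetIncl K X N (Nat.zero_le r) ≫ f = 0 := by
  have h₁ := Subobject.underlyingIso_arrow (jetIncl K X N (Nat.zero_le r))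
  have h₂ := Subobject.underlyingIso_hom_comp_eq_mk (jetIncl K X N (Nat.zero_le r))
  constructor
  · intro h
    rw [← h₁, Category.assoc]
    exact (congrArg (_ ≫ ·) h).trans comp_zero
  · intro h
    refine (congrArg (· ≫ f) h₂.symm).trans ?_
    change (_ ≫ _) ≫ f = 0
    rw [Category.assoc, h, comp_zero]

/-- The quotient of the bundle by the fields of degree at least one is the bundle of linear
parts. -/
lemma exists_cokernel_iso_matrix [SmoothOfRelativeDimension N (X ↘ Spec (.of K))] :
    ∃ e : cokernel (degreeFiltration K X N 1).arrow ≅ (matrixCocycle K X N).sheaf,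
      cokernel.π (degreeFiltration K X N 1).arrow ≫ e.hom = linearPartHom K X N := by
  let π : (formalVFBundle K X N).E ⟶ (matrixCocycle K X N).sheaf := linearPartHom K X N
  have : Epi π := epi_linearPartHom K X N
  have hw : (degreeFiltration K X N 1).arrow ≫ π = 0 :=
    degreeFiltration_arrow_comp.2 (jetIncl_linearPartHom K X N)
  have hk : IsLimit (KernelFork.ofι (degreeFiltration K X N 1).arrow hw) := by
    refine KernelFork.IsLimit.ofι' _ hw fun {G} g hg => ?_
    have := Scheme.Modules.exists_lift (degreeFiltration K X N 1).arrow g fun W s =>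
      (exists_degreeFiltration_iff K X N 1 W _).2
        (exists_jetIncl_of_linearPartHom K X N _ (Scheme.Modules.app_congr hg W s))
    exact ⟨this.choose, this.choose_spec⟩
  -- In an abelian category an epimorphism is the cokernel of its kernel, here the inclusion of the
  -- first filtration step.
  have hc := Abelian.epiIsCokernelOfKernel _ hk
  exact ⟨(cokernelIsCokernel _).coconePointUniqueUpToIso hc,
    (cokernelIsCokernel (degreeFiltration K X N 1).arrow).comp_coconePointUniqueUpToIso_hom hc
      WalkingParallelPair.one⟩

end Bundle
end

noncomputable section

/-! ### The matrices of `(1,1)`-tensors -/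

namespace IsUniformizing

variable {K A : Type u} [Field K] [CommRing A] [Algebra K A] {N : ℕ} {x y : Fin N → A}

/-- The matrix of the `(1,1)`-tensor `ω ⊗ D`. -/
def tensorMatrix (h : IsUniformizing K x) :
    KaehlerDifferential K A →ₗ[A] Derivation K A A →ₗ[A] (Fin N × Fin N → A) :=
  LinearMap.mk₂ A (fun ω D ij => (h.pderiv ij.1).liftKaehlerDifferential ω * D (x ij.2))
    (fun _ _ _ => by ext1; simp [add_mul]) (fun _ _ _ => by ext1; simp [mul_assoc])
    (fun _ _ _ => by ext1; simp [mul_add]) (fun _ _ _ => by ext1; simp [mul_left_comm])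

lemma tensorMatrix_apply (h : IsUniformizing K x) (ω : KaehlerDifferential K A)
    (D : Derivation K A A) (ij : Fin N × Fin N) :
    h.tensorMatrix ω D ij = (h.pderiv ij.1).liftKaehlerDifferential ω * D (x ij.2) := rfl

variable [CharZero K] [IsDomain A]

/-- On exact differentials this is the chain rule, and they span. -/
lemma liftKaehlerDifferential_pderiv_eq_sum (hx : IsUniformizing K x) (hy : IsUniformizing K y)
    (k : Fin N) (ω : KaehlerDifferential K A) :
    (hy.pderiv k).liftKaehlerDifferential ω =
      ∑ i, (hx.pderiv i).liftKaehlerDifferential ω * hy.pderiv k (x i) := by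
  have hω : ω ∈ Submodule.span A (Set.range (KaehlerDifferential.D K A)) := by
    rw [KaehlerDifferential.span_range_derivation]
    trivial
  induction hω using Submodule.span_induction with
  | mem ω h =>
    obtain ⟨f, rfl⟩ := h
    simp only [Derivation.liftKaehlerDifferential_comp_D]
    rw [hx.derivation_apply]
    exact Finset.sum_congr rfl fun i _ => mul_comm _ _
  | zero => simp
  | add ω η _ _ h₁ h₂ => simp [h₁, h₂, add_mul, Finset.sum_add_distrib]
  | smul a ω _ h => simp [h, Finset.mul_sum, mul_assoc]

/-- The differential transforms by `∂x/∂y` and the vector field by `∂y/∂x`, the same rule as for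
linear parts in `coeff_single_transition`. -/
lemma tensorMatrix_change (hx : IsUniformizing K x) (hy : IsUniformizing K y)
    (ω : KaehlerDifferential K A) (D : Derivation K A A) (k l : Fin N) :
    ∑ j, ∑ i, hx.tensorMatrix ω D (i, j) * hy.pderiv k (x i) * hx.pderiv j (y l) =
      hy.tensorMatrix ω D (k, l) := by
  simp only [tensorMatrix_apply]
  rw [liftKaehlerDifferential_pderiv_eq_sum hx hy, hx.derivation_apply D (y l),
    Finset.sum_mul_sum, Finset.sum_comm]
  exact Finset.sum_congr rfl fun i _ => Finset.sum_congr rfl fun j _ => by ring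

end IsUniformizing

section Tensors

variable {K : Type u} [Field K] {X : Scheme.{u}} [X.Over (Spec (.of K))] {N : ℕ}

/-- Restriction of differentials. -/
def kaehlerRes {V W : X.Opens} (h : V ≤ W) :
    KaehlerDifferential K Γ(X, W) →+ KaehlerDifferential K Γ(X, V) :=
  ((kaehlerPresheaf K X).presheaf.map (homOfLE h).op).hom

lemma kaehlerRes_D {V W : X.Opens} (h : V ≤ W) (f : Γ(X, W)) :
    kaehlerRes h (KaehlerDifferential.D K Γ(X, W) f) =
      KaehlerDifferential.D K Γ(X, V) (resFun h f) :=
  PresheafOfModules.DifferentialsConstruction.relativeDifferentials'_map_d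
    (constToStructureSheaf K X) (homOfLE h).op f

lemma kaehlerRes_smul {V W : X.Opens} (h : V ≤ W) (a : Γ(X, W))
    (ω : KaehlerDifferential K Γ(X, W)) :
    kaehlerRes h (a • ω) = resFun h a • kaehlerRes h ω :=
  (kaehlerPresheaf K X).map_smul (homOfLE h).op a ω

lemma kaehlerRes_kaehlerRes {U V W : X.Opens} (h : U ≤ V) (h' : V ≤ W)
    (ω : KaehlerDifferential K Γ(X, W)) :
    kaehlerRes h (kaehlerRes h' ω) = kaehlerRes (h.trans h') ω :=
  congr($((kaehlerPresheaf K X).presheaf.map_comp (homOfLE h').op (homOfLE h).op) ω).symm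

lemma kaehlerRes_self {V : X.Opens} (ω : KaehlerDifferential K Γ(X, V)) :
    kaehlerRes le_rfl ω = ω :=
  congr($((kaehlerPresheaf K X).presheaf.map_id (op V)) ω)

lemma resVF_apply {V W : X.Opens} (h : V ≤ W) (D : vectorFields K X W)
    (V' : {V' : X.Opens // V' ≤ V}) : (resVF h D).1 V' = D.1 ⟨V'.1, V'.2.trans h⟩ := rfl

lemma vectorFields_smul_apply {W : X.Opens} (a : Γ(X, W)) (D : vectorFields K X W)
    (V : {V : X.Opens // V ≤ W}) : (a • D).1 V = resFun V.2 a • D.1 V := rfl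

variable [CharZero K] [IsIntegral X]

lemma EtaleChart.resFun_liftKaehlerDifferential (c : EtaleChart K X N) {V W : X.Opens}
    [Nonempty V] [Nonempty W] (h : V ≤ W) (hW : W ≤ c.U) (i : Fin N)
    (ω : KaehlerDifferential K Γ(X, W)) :
    resFun h (((c.uniformizing hW).pderiv i).liftKaehlerDifferential ω) =
      ((c.uniformizing (h.trans hW)).pderiv i).liftKaehlerDifferential (kaehlerRes h ω) := by
  have hω : ω ∈ Submodule.span Γ(X, W) (Set.range (KaehlerDifferential.D K Γ(X, W))) := by
    rw [KaehlerDifferential.span_range_derivation]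
    trivial
  induction hω using Submodule.span_induction with
  | mem ω hf =>
    obtain ⟨f, rfl⟩ := hf
    rw [kaehlerRes_D, Derivation.liftKaehlerDifferential_comp_D,
      Derivation.liftKaehlerDifferential_comp_D, c.resFun_pderiv]
  | zero => simp
  | add ω η _ _ h₁ h₂ => simp [h₁, h₂]
  | smul a ω _ hω => rw [map_smul, smul_eq_mul, map_mul, hω, kaehlerRes_smul, map_smul,
      smul_eq_mul]

/-- The matrices of `ω ⊗ D` in all charts. -/
def tensorSection {W : X.Opens} (ω : KaehlerDifferential K Γ(X, W)) (D : vectorFields K X W) :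
    (matrixCocycle K X N).sections W :=
  ⟨fun p => (p.c.uniformizing p.le_chart).tensorMatrix (kaehlerRes p.le ω) (D.1 ⟨p.V, p.le⟩),
    fun p q h => by
      have hres : ∀ ij, resFun h ((p.c.uniformizing p.le_chart).tensorMatrix (kaehlerRes p.le ω)
          (D.1 ⟨p.V, p.le⟩) ij) = (p.c.uniformizing (h.trans p.le_chart)).tensorMatrix
            (kaehlerRes q.le ω) (D.1 ⟨q.V, q.le⟩) ij := by
        intro ij
        rw [IsUniformizing.tensorMatrix_apply, IsUniformizing.tensorMatrix_apply, map_mul,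
          p.c.resFun_liftKaehlerDifferential, kaehlerRes_kaehlerRes,
          ← D.2 ⟨p.V, p.le⟩ ⟨q.V, q.le⟩ h, p.c.resFun_param]
      simp only [hres]
      ext1 kl
      exact IsUniformizing.tensorMatrix_change _ _ _ _ kl.1 kl.2⟩

lemma tensorSection_apply {W : X.Opens} (ω : KaehlerDifferential K Γ(X, W))
    (D : vectorFields K X W) (p : ChartOpen K X N W) :
    (tensorSection ω D).1 p = (p.c.uniformizing p.le_chart).tensorMatrix (kaehlerRes p.le ω)
      (D.1 ⟨p.V, p.le⟩) := rfl

variable (K X N) in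
/-- The matrices of `(1,1)`-tensors. -/
def tensorSections (W : X.Opens) :
    TensorProduct Γ(X, W) (KaehlerDifferential K Γ(X, W)) (vectorFields K X W) →ₗ[Γ(X, W)]
      (matrixCocycle K X N).sections W :=
  TensorProduct.lift <| LinearMap.mk₂ Γ(X, W) tensorSection
    (fun ω η D => Subtype.ext <| funext fun p => by
      change (tensorSection (ω + η) D).1 p = (tensorSection ω D).1 p + (tensorSection η D).1 p
      simp only [tensorSection_apply, map_add, LinearMap.add_apply])
    (fun a ω D => Subtype.ext <| funext fun p => by
      change (tensorSection (a • ω) D).1 p = resFun p.le a • (tensorSection ω D).1 p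
      simp only [tensorSection_apply, kaehlerRes_smul, map_smul, LinearMap.smul_apply])
    (fun ω D E => Subtype.ext <| funext fun p => by
      change (tensorSection ω (D + E)).1 p = (tensorSection ω D).1 p + (tensorSection ω E).1 p
      simp only [tensorSection_apply, ← map_add]
      rfl)
    (fun a ω D => Subtype.ext <| funext fun p => by
      change (tensorSection ω (a • D)).1 p = resFun p.le a • (tensorSection ω D).1 p
      simp only [tensorSection_apply, vectorFields_smul_apply, map_smul])

lemma tensorSections_tmul {W : X.Opens} (ω : KaehlerDifferential K Γ(X, W))
    (D : vectorFields K X W) : tensorSections K X N W (ω ⊗ₜ D) = tensorSection ω D := rfl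

variable (K X N) in
/-- The morphism from the presheaf tensor product to the sheaf of matrices. -/
def tensorPresheafHom : tensorPresheaf K X ⟶ (matrixCocycle K X N).presheaf :=
  PresheafOfModules.homMk
    { app := fun W => AddCommGrpCat.ofHom (tensorSections K X N W.unop).toAddMonoidHom
      naturality := fun W V i => by
        ext (t : TensorProduct Γ(X, W.unop) (KaehlerDifferential K Γ(X, W.unop))
          (vectorFields K X W.unop))
        induction t using TensorProduct.induction_on with
        | zero => exact (map_zero _).trans (map_zero _).symm
        | add s t hs ht =>
          exact (map_add _ _ _).trans ((congrArg₂ (· + ·) hs ht).trans (map_add _ _ _).symm)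
        | tmul ω D =>
          change tensorSection (kaehlerRes i.unop.le ω) (resVF i.unop.le D) =
            (matrixCocycle K X N).restrict i.unop.le (tensorSection ω D)
          refine Subtype.ext <| funext fun p => ?_
          rw [ChartCocycle.restrict_apply, tensorSection_apply, tensorSection_apply,
            kaehlerRes_kaehlerRes]
          rfl }
    fun W a t => (tensorSections K X N W.unop).map_smul a t

end Tensors
end

noncomputable section

/-! ### The sheaf of `(1,1)`-tensors -/

section Tensors

variable {K : Type u} [Field K] [CharZero K] {X : Scheme.{u}} [X.Over (Spec (.of K))]
  [IsIntegral X] {N : ℕ}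

omit [CharZero K] [IsIntegral X] in
-- When a chart contains the whole open set, its component determines all the others through the
-- transition maps.
lemma ChartCocycle.sections_ext {ι : Type} (P : ChartCocycle K X N ι) (c : EtaleChart K X N)
    {V : X.Opens} [hV : Nonempty V] (h : V ≤ c.U) {s t : P.sections V}
    (hst : ∀ i, s.1 ⟨c, V, hV, le_rfl, h⟩ i = t.1 ⟨c, V, hV, le_rfl, h⟩ i) : s = t := by
  refine Subtype.ext <| funext fun p => ?_
  rw [← s.2 ⟨c, V, hV, le_rfl, h⟩ p p.le, ← t.2 ⟨c, V, hV, le_rfl, h⟩ p p.le]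
  simp only [hst]

lemma EtaleChart.vectorFields_eq_zero (c : EtaleChart K X N) {V : X.Opens} (h : V ≤ c.U)
    (D : vectorFields K X V) (hD : ∀ j, D.1 ⟨V, le_rfl⟩ (c.param h j) = 0) : D = 0 := by
  refine Subtype.ext <| funext fun V' => ?_
  by_cases hne : Nonempty V'.1
  · apply (c.uniformizing (V'.2.trans h)).derivation_eq_zero
    intro j
    rw [← c.resFun_param V'.2 h, D.2 ⟨V, le_rfl⟩ V' V'.2, hD, map_zero]
  · have := subsingleton_sections hne
    ext f
    exact Subsingleton.elim _ _

omit [CharZero K] in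
lemma EtaleChart.tensorMatrix_D_param (c : EtaleChart K X N) {V : X.Opens} [Nonempty V]
    (h : V ≤ c.U) (D : Derivation K Γ(X, V) Γ(X, V)) (i i' j : Fin N) :
    (c.uniformizing h).tensorMatrix (KaehlerDifferential.D K _ (c.param h i)) D (i', j) =
      if i = i' then D (c.param h j) else 0 := by
  classical
  rw [IsUniformizing.tensorMatrix_apply, Derivation.liftKaehlerDifferential_comp_D,
    IsUniformizing.pderiv_param, Pi.single_apply]
  split_ifs <;> simp

lemma EtaleChart.tensorSections_sum_apply (c : EtaleChart K X N) {V : X.Opens} [hV : Nonempty V]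
    (h : V ≤ c.U) (D : Fin N → vectorFields K X V) (ij : Fin N × Fin N) :
    (tensorSections K X N V
      (∑ i, KaehlerDifferential.D K _ (c.param h i) ⊗ₜ D i)).1 ⟨c, V, hV, le_rfl, h⟩ ij =
      (D ij.1).1 ⟨V, le_rfl⟩ (c.param h ij.2) := by
  let f : (matrixCocycle K X N).sections V →+ Γ(X, V) :=
    { toFun := fun s => s.1 ⟨c, V, hV, le_rfl, h⟩ ij
      map_zero' := rfl
      map_add' := fun _ _ => rfl }
  change f _ = _
  rw [map_sum, map_sum]
  have : ∀ i, f (tensorSections K X N V (KaehlerDifferential.D K _ (c.param h i) ⊗ₜ D i)) =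
      if i = ij.1 then (D i).1 ⟨V, le_rfl⟩ (c.param h ij.2) else 0 := by
    intro i
    rw [tensorSections_tmul]
    change (tensorSection _ _).1 ⟨c, V, hV, le_rfl, h⟩ ij = _
    rw [tensorSection_apply, kaehlerRes_self]
    exact c.tensorMatrix_D_param h _ _ _ _
  simp [this]

variable [SmoothOfRelativeDimension N (X ↘ Spec (.of K))]

/-- On an affine open subset of a chart the `dxᵢ` form a basis of the differentials, and
coefficients can be moved across the tensor product. -/
lemma EtaleChart.exists_eq_sum_tmul (c : EtaleChart K X N) {V : X.Opens} [Nonempty V]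
    (hVa : IsAffineOpen V) (h : V ≤ c.U)
    (t : TensorProduct Γ(X, V) (KaehlerDifferential K Γ(X, V)) (vectorFields K X V)) :
    ∃ D : Fin N → vectorFields K X V,
      t = ∑ i, KaehlerDifferential.D K _ (c.param h i) ⊗ₜ D i := by
  have := projective_kaehler (K := K) (N := N) hVa
  obtain ⟨b, hb⟩ := (c.uniformizing h).exists_basis_kaehler
  induction t using TensorProduct.induction_on with
  | zero => exact ⟨0, by simp⟩
  | add s t hs ht =>
    obtain ⟨D, rfl⟩ := hs
    obtain ⟨E, rfl⟩ := ht
    exact ⟨D + E, by simp [TensorProduct.tmul_add, Finset.sum_add_distrib]⟩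
  | tmul ω D =>
    refine ⟨fun i => b.repr ω i • D, ?_⟩
    conv_lhs => rw [← b.sum_repr ω, TensorProduct.sum_tmul]
    exact Finset.sum_congr rfl fun i _ => by rw [TensorProduct.smul_tmul, hb]

/-- Written as `∑ᵢ dxᵢ ⊗ Dᵢ`, the tensor has the matrix with entries `Dᵢ(xⱼ)`, and a vector field
that kills the parameters is zero. -/
lemma EtaleChart.tensorSections_injective (c : EtaleChart K X N) {V : X.Opens} [hV : Nonempty V]
    (hVa : IsAffineOpen V) (h : V ≤ c.U) : Function.Injective (tensorSections K X N V) := by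
  rw [injective_iff_map_eq_zero]
  intro t ht
  obtain ⟨D, rfl⟩ := c.exists_eq_sum_tmul hVa h t
  have hD : ∀ i, D i = 0 := fun i => c.vectorFields_eq_zero h _ fun j => by
    rw [← c.tensorSections_sum_apply h D (i, j), ht]
    rfl
  simp [hD]

omit [SmoothOfRelativeDimension N (X ↘ Spec (.of K))] in
-- The matrix `a` comes from `∑ᵢ dxᵢ ⊗ ∑ⱼ aᵢⱼ ∂/∂xⱼ`; for this direction the open set need not be
-- affine.
lemma EtaleChart.tensorSections_surjective (c : EtaleChart K X N) {V : X.Opens} [hV : Nonempty V]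
    (h : V ≤ c.U) : Function.Surjective (tensorSections K X N V) := by
  intro s
  let D : Fin N → vectorFields K X V := fun i =>
    ∑ j, s.1 ⟨c, V, hV, le_rfl, h⟩ (i, j) • resVF h (c.vectorField j)
  refine ⟨∑ i, KaehlerDifferential.D K _ (c.param h i) ⊗ₜ D i, ?_⟩
  apply (matrixCocycle K X N).sections_ext c h
  rintro ⟨i, j⟩
  rw [c.tensorSections_sum_apply h D]
  let f : vectorFields K X V →+ Γ(X, V) :=
    { toFun := fun E => E.1 ⟨V, le_rfl⟩ (c.param h j)
      map_zero' := rfl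
      map_add' := fun _ _ => rfl }
  have : ∀ k, f (s.1 ⟨c, V, hV, le_rfl, h⟩ (i, k) • resVF h (c.vectorField k)) =
      if j = k then s.1 ⟨c, V, hV, le_rfl, h⟩ (i, k) else 0 := by
    classical
    intro k
    change (s.1 ⟨c, V, hV, le_rfl, h⟩ (i, k) • resVF h (c.vectorField k)).1 ⟨V, le_rfl⟩
      (c.param h j) = _
    rw [vectorFields_smul_apply, Derivation.smul_apply, resVF_apply, c.vectorField_apply k ⟨V, h⟩,
      IsUniformizing.pderiv_param, Pi.single_apply, resFun_self]
    split_ifs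
    all_goals simp_all
  change f (∑ j, _) = _
  rw [map_sum]
  simp [this]

lemma exists_affine_chart (W : X.Opens) (P : X) (hP : P ∈ W) :
    ∃ (c : EtaleChart K X N) (V : X.Opens), IsAffineOpen V ∧ P ∈ V ∧ V ≤ W ∧ V ≤ c.U := by
  obtain ⟨c, hc⟩ := exists_etaleChart (K := K) (N := N) P
  obtain ⟨V, hV, hPV, hle⟩ := exists_isAffineOpen_mem_and_subset (U := W ⊓ c.U) ⟨hP, hc⟩
  exact ⟨c, V, hV, hPV, hle.trans inf_le_left, hle.trans inf_le_right⟩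

variable (K X N)

instance isLocallyInjective_tensorPresheafHom :
    Presheaf.IsLocallyInjective (Opens.grothendieckTopology X)
      ((PresheafOfModules.toPresheaf _).map (tensorPresheafHom K X N)) where
  equalizerSieve_mem {W} s t hst := by
    intro P hP
    obtain ⟨c, V, hVa, hPV, hVW, hVc⟩ := exists_affine_chart (K := K) (N := N) W.unop P hP
    have : Nonempty V := ⟨⟨P, hPV⟩⟩
    refine ⟨V, homOfLE hVW, ?_, hPV⟩
    apply c.tensorSections_injective hVa hVc
    have hn := ((PresheafOfModules.toPresheaf _).map (tensorPresheafHom K X N)).naturality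
      (homOfLE hVW).op
    exact (congr($hn s)).trans ((congrArg ((matrixCocycle K X N).restrict hVW) hst).trans (congr($hn t)).symm)

instance isLocallySurjective_tensorPresheafHom :
    Presheaf.IsLocallySurjective (Opens.grothendieckTopology X)
      ((PresheafOfModules.toPresheaf _).map (tensorPresheafHom K X N)) where
  imageSieve_mem {W} s := by
    intro P hP
    obtain ⟨c, V, hVa, hPV, hVW, hVc⟩ := exists_affine_chart (K := K) (N := N) W P hP
    have : Nonempty V := ⟨⟨P, hPV⟩⟩
    exact ⟨V, homOfLE hVW, c.tensorSections_surjective hVc _, hPV⟩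

/-- The isomorphism from `(1,1)`-tensors to matrices. -/
lemma exists_oneOneTensors_iso :
    ∃ e : oneOneTensors K X ≅ (matrixCocycle K X N).sheaf,
      toSheafify (Opens.grothendieckTopology X) (tensorPresheaf K X).presheaf ≫
        e.hom.mapPresheaf =
      (PresheafOfModules.toPresheaf _).map (tensorPresheafHom K X N) := by
  let ψ : tensorPresheaf K X ⟶ (PresheafOfModules.restrictScalars (𝟙 X.ringCatSheaf.obj)).obj
      ((SheafOfModules.forget _).obj (matrixCocycle K X N).sheaf) :=
    PresheafOfModules.homMk ((PresheafOfModules.toPresheaf _).map (tensorPresheafHom K X N))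
      fun W a t => (tensorSections K X N W.unop).map_smul a t
  let f := (PresheafOfModules.sheafificationHomEquiv (𝟙 X.ringCatSheaf.obj)).symm ψ
  have hf : toSheafify (Opens.grothendieckTopology X) (tensorPresheaf K X).presheaf ≫
      (PresheafOfModules.toPresheaf _).map f.val =
      (PresheafOfModules.toPresheaf _).map (tensorPresheafHom K X N) :=
    congrArg (fun g => (PresheafOfModules.toPresheaf _).map g) (Equiv.apply_symm_apply
      (PresheafOfModules.sheafificationHomEquiv (𝟙 X.ringCatSheaf.obj)) ψ)
  -- Sheafification and the locally bijective presheaf map both become isomorphisms of sheaves,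
  -- hence so does `f` by two out of three. As `f` is already a map of sheaves, it is an
  -- isomorphism.
  have hW : (Opens.grothendieckTopology X).W ((PresheafOfModules.toPresheaf _).map f.val) := by
    refine MorphismProperty.of_precomp _ _ _
      ((Opens.grothendieckTopology X).W_toSheafify (tensorPresheaf K X).presheaf) ?_
    exact (congrArg (fun k => (Opens.grothendieckTopology X).W k) hf).mpr
      ((GrothendieckTopology.W_iff_isLocallyBijective _ _).2
        ⟨isLocallyInjective_tensorPresheafHom K X N, isLocallySurjective_tensorPresheafHom K X N⟩)
  have hiso : IsIso ((SheafOfModules.toSheaf _).map f) := by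
    exact ((Opens.grothendieckTopology X).W_sheafToPresheaf_map_iff_isIso _).1 hW
  have : IsIso f := isIso_of_reflects_iso f (SheafOfModules.toSheaf _)
  have : IsIso (show oneOneTensors K X ⟶ (matrixCocycle K X N).sheaf from f) := this
  exact ⟨asIso (show oneOneTensors K X ⟶ (matrixCocycle K X N).sheaf from f), hf⟩

end Tensors
end

/-! ### The quotient by fields of degree at least one and the theorem. -/

noncomputable section

section Main

variable {K : Type u} [Field K] [CharZero K] {X : Scheme.{u}} [X.Over (Spec (.of K))]
  [IsIntegral X] {N : ℕ}

/-- The matrix of `dxᵢ ⊗ ∂/∂xⱼ` in its own chart. -/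
lemma EtaleChart.tensorSection_dParam (c : EtaleChart K X N) [hc : Nonempty c.U]
    (i j : Fin N) (kl : Fin N × Fin N) :
    (tensorSection (KaehlerDifferential.D K _ (c.x i)) (c.vectorField j)).1
      ⟨c, c.U, hc, le_rfl, le_rfl⟩ kl = if (i, j) = kl then 1 else 0 := by
  have hx : c.x i = c.param le_rfl i := (resFun_self _ _).symm
  rw [tensorSection_apply, kaehlerRes_self, hx, c.tensorMatrix_D_param,
    c.vectorField_apply j ⟨c.U, le_rfl⟩, IsUniformizing.pderiv_param, Pi.single_apply]
  simp only [Prod.ext_iff]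
  split_ifs <;> simp_all

variable [SmoothOfRelativeDimension N (X ↘ Spec (.of K))]

/-- Both sheaves are isomorphic to the sheaf of matrices. There the class of a section becomes its
linear part and `dxᵢ ⊗ ∂/∂xⱼ` becomes an elementary matrix, so the formula can be read off entry by
entry in the given chart. -/
lemma exists_isLinearPart_degreeFiltration :
    ∃ Φ : cokernel (degreeFiltration K X N 1).arrow ≅ oneOneTensors K X,
      (formalVFBundle K X N).IsLinearPart (degreeFiltration K X N 1) Φ := by
  obtain ⟨a, ha⟩ := exists_cokernel_iso_matrix (K := K) (X := X) (N := N)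
  obtain ⟨b, hb⟩ := exists_oneOneTensors_iso K X N
  refine ⟨a ≪≫ b.symm, fun c => ⟨c.vectorField, c.vectorField_self, fun e => ?_⟩⟩
  have hc := c.nonempty
  have hbinj := Scheme.Modules.injective_app_of_mono b.hom c.U
  apply hbinj
  have hdT : ∀ i j, b.hom.app c.U (dTensor K X (c.x i) (c.vectorField j)) =
      tensorSection (KaehlerDifferential.D K _ (c.x i)) (c.vectorField j) := fun i j =>
    congr($(NatTrans.congr_app hb (op c.U)) (KaehlerDifferential.D K Γ(X, c.U) (c.x i) ⊗ₜ
      c.vectorField j : TensorProduct Γ(X, c.U) (KaehlerDifferential K Γ(X, c.U))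
        (vectorFields K X c.U)))
  have hl : b.hom.app c.U ((a ≪≫ b.symm).hom.app c.U
      ((cokernel.π (degreeFiltration K X N 1).arrow).app c.U e)) =
      (linearPartHom K X N).app c.U e := by
    refine Eq.trans ?_ (Scheme.Modules.app_congr ha c.U e)
    have : (a ≪≫ b.symm).hom ≫ b.hom = a.hom := by simp
    exact Scheme.Modules.app_congr this c.U _
  refine hl.trans ?_
  have hr : ∀ r : Fin N → Fin N → Γ(X, c.U),
      b.hom.app c.U (∑ i, ∑ j, r i j • dTensor K X (c.x i) (c.vectorField j)) =
        (∑ i, ∑ j, r i j • tensorSection (KaehlerDifferential.D K _ (c.x i)) (c.vectorField j) :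
          (matrixCocycle K X N).sections c.U) := by
    intro r
    rw [map_sum]
    refine Finset.sum_congr rfl fun i _ => ?_
    rw [map_sum]
    refine Finset.sum_congr rfl fun j _ => ?_
    rw [Scheme.Modules.Hom.app_smul, hdT]
    rfl
  refine Eq.trans ?_ (hr _).symm
  apply (matrixCocycle K X N).sections_ext c le_rfl
  intro kl
  let f : (matrixCocycle K X N).sections c.U →+ Γ(X, c.U) :=
    { toFun := fun s => s.1 ⟨c, c.U, hc, le_rfl, le_rfl⟩ kl
      map_zero' := rfl
      map_add' := fun _ _ => rfl }
  have hf : ∀ (r : Γ(X, c.U)) (i j : Fin N),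
      f (r • tensorSection (KaehlerDifferential.D K _ (c.x i)) (c.vectorField j)) =
        if (i, j) = kl then r else 0 := by
    intro r i j
    change resFun le_rfl r * (tensorSection _ _).1 ⟨c, c.U, hc, le_rfl, le_rfl⟩ kl = _
    rw [c.tensorSection_dParam, resFun_self]
    split_ifs <;> simp
  change linearPart N Γ(X, c.U) _ kl = f (∑ i, _)
  simp only [map_sum, hf]
  rw [← Fintype.sum_prod_type' (f := fun i j => if (i, j) = kl then _ else _)]
  simp only [Prod.mk.eta, Finset.sum_ite_eq', Finset.mem_univ, if_true]
  exact congrFun (congrArg (linearPart N Γ(X, c.U))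
    ((jetCocycle K X N 0).triv_apply c c.U le_rfl e).symm) kl

end Main
end

theorem theorem27 {K : Type u} [Field K] [IsAlgClosed K] [CharZero K] (N : ℕ) (X : Scheme.{u})
    [X.Over (Spec (.of K))] [IsIntegral X] [SmoothOfRelativeDimension N (X ↘ Spec (.of K))]
    [IsSeparated (X ↘ Spec (.of K))] [QuasiCompact (X ↘ Spec (.of K))] :
    (∀ P : X, ∃ c : EtaleChart K X N, P ∈ c.U) ∧
    ∃ L : LPlusBundle K X N, L.HasTransitionFormula ∧
      ∃ F : ℕ → Subobject L.E, L.IsDegreeFiltration F ∧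
        (∀ r : ℕ, L.QuotientIsVectorBundle r (F r)) ∧
        ∃ Φ : cokernel (F 1).arrow ≅ oneOneTensors K X, L.IsLinearPart (F 1) Φ := by
  obtain ⟨Φ, hΦ⟩ := exists_isLinearPart_degreeFiltration (K := K) (X := X) (N := N)
  exact ⟨exists_etaleChart, formalVFBundle K X N, hasTransitionFormula_formalVFBundle K X N,
    degreeFiltration K X N, isDegreeFiltration_degreeFiltration K X N,
    (isDegreeFiltration_degreeFiltration K X N).quotientIsVectorBundle, Φ, hΦ⟩
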